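/- Let $G$ be a set of ordered pairs in $[n]^2$ (a graph on $[n]$; both orientations of a pair, and loops, are allowed). A 2XOR instance on $G$ is a choice of signs $b_{uv}\in\{\pm1\}$, $(u,v)\in G$, with constraints $x_ux_v=b_{uv}$; an assignment $x\in\{\pm1\}^n$ is $(1-\eta)$-satisfying if it satisfies at least $(1-\eta)|G|$ of the $|G|$ constraints. For $m\le n^2$, let $\mathcal H_2(m,n)$ be the random graph in which each of the $n^2$ ordered pairs is included independently with probability $m/n^2$. Put $$B_n(\eta)=\begin{cases}2,&\eta\le \frac1{3n},\\ 2e^{3\eta n\log n},&\eta>\frac1{3n}.\end{cases}$$ **Theorem.** There is an absolute constant $c>0$ such that for every constant $\delta\in(0,1]$ there are a deterministic polynomial-time algorithm, which accepts or rejects graphs, and a number $n_0=n_0(\delta)$ with the following properties. Define the certified value for $\eta\in[0,1]$ on a graph $G$ with $n$ vertices to be $B_n(\eta)$ if $G$ is accepted and $2^n$ if $G$ is rejected. 1. (Certification.) For every $n$, every graph $G$ on $[n]$, every $\eta\in[0,1]$ and every 2XOR instance on $G$, the number of $(1-\eta)$-satisfying assignments is at most the certified value. 2. (Closeness.) If $G$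 is accepted, then for every $\eta\in[0,1]$, every 2XOR instance on $G$ and any two of its $(1-\eta)$-satisfying assignments $x,x'$, the Hamming distance of $x'$ from $x$ or from $-x$ is at most $3\eta n$. 3. (Success probability.) For all $n\ge n_0$, a random graph from $\mathcal H_2(m,n)$ with $m=n^{1+\delta}$ is accepted, so that its certified value is $B_n(\eta)$ for all $\eta\in[0,1]$ simultaneously, with probability at least $1-\exp(-n^{c\delta})$. -/

import Mathlib

open MeasureTheory

namespace TwoXor

/-! ### Graphs, 2XOR instances and the random graph -/

/-- A `2`-uniform hypergraph on the vertex set `Fin n`: a set of ordered pairs (loops allowed),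
given by its indicator function. -/
abbrev PairGraph (n : ℕ) : Type := Fin n × Fin n → Bool

/-- The edge set of a graph. -/
def edges {n : ℕ} (G : PairGraph n) : Finset (Fin n × Fin n) :=
  Finset.univ.filter fun e => G e = true

/-- An assignment in `{1, -1}ⁿ`. -/
abbrev Assignment (n : ℕ) : Type := Fin n → ℤˣ

/-- The signs of a 2XOR instance: the instance on `G` with signs `b` has, for every edge `(u, v)`
of `G`, the constraint `x u * x v = b (u, v)`.  Values of `b` off the edges of `G` play no role. -/
abbrev Signing (n : ℕ) : Type := Fin n × Fin n → ℤˣ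

/-- The constraints of the instance `(G, b)` that `x` satisfies. -/
def satisfied {n : ℕ} (G : PairGraph n) (b : Signing n) (x : Assignment n) :
    Finset (Fin n × Fin n) :=
  (edges G).filter fun e => x e.1 * x e.2 = b e

/-- `x` is `(1 - η)`-satisfying for the instance `(G, b)`: it satisfies at least a `1 - η` fraction
of the constraints. -/
def IsApproxSat {n : ℕ} (G : PairGraph n) (b : Signing n) (η : ℝ) (x : Assignment n) : Prop :=
  (1 - η) * ((edges G).card : ℝ) ≤ ((satisfied G b x).card : ℝ)

/-- The random graph: each of the `n²` ordered pairs is an edge independently with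
probability `m / n²` (a number which is clamped to `[0, 1]` if it lies outside). -/
noncomputable def randomGraph (n : ℕ) (m : ℝ) : Measure (PairGraph n) :=
  Measure.pi fun _ => ProbabilityTheory.bernoulliMeasure true false
    (Set.projIcc (0 : ℝ) 1 zero_le_one (m / (n : ℝ) ^ 2))

/-! ### Polynomial time

Random access machines with unit-cost steps: finitely many registers and an unbounded memory with
indirect addressing, all holding natural numbers.  The arithmetic operations are addition and
truncated subtraction, so that `t` steps increase bit lengths by at most `t`, and time on this
machine agrees with Turing machine time up to a polynomial. -/

/-- Programs of the machine.  A program mentions finitely many registers, named by numerals. -/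
inductive Prog : Type
  | const (d c : ℕ)
  | add (d a b : ℕ)
  | sub (d a b : ℕ)
  | load (d a : ℕ)
  | store (a s : ℕ)
  | seq (p q : Prog)
  | ifPos (r : ℕ) (p q : Prog)
  | whilePos (r : ℕ) (p : Prog)

/-- The contents of the registers and of the memory. -/
structure State : Type where
  reg : ℕ → ℕ
  mem : ℕ → ℕ

/-- The state after register `d` has been set to `v`. -/
def State.setReg (s : State) (d v : ℕ) : State := ⟨Function.update s.reg d v, s.mem⟩

/-- The state after the memory cell with address `a` has been set to `v`. -/
def State.setMem (s : State) (a v : ℕ) : State := ⟨s.reg, Function.update s.mem a v⟩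

/-- `Runs p s s' t`: started in state `s`, program `p` halts in state `s'` after exactly `t` steps.
Each basic instruction and each test of a register takes one step. -/
inductive Runs : Prog → State → State → ℕ → Prop
  | const (s : State) (d c : ℕ) : Runs (.const d c) s (s.setReg d c) 1
  | add (s : State) (d a b : ℕ) : Runs (.add d a b) s (s.setReg d (s.reg a + s.reg b)) 1
  | sub (s : State) (d a b : ℕ) : Runs (.sub d a b) s (s.setReg d (s.reg a - s.reg b)) 1
  | load (s : State) (d a : ℕ) : Runs (.load d a) s (s.setReg d (s.mem (s.reg a))) 1
  | store (s : State) (a r : ℕ) : Runs (.store a r) s (s.setMem (s.reg a) (s.reg r)) 1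
  | seq {p q : Prog} {s₁ s₂ s₃ : State} {t₁ t₂ : ℕ} :
      Runs p s₁ s₂ t₁ → Runs q s₂ s₃ t₂ → Runs (.seq p q) s₁ s₃ (t₁ + t₂)
  | ifTrue {r : ℕ} {p q : Prog} {s s' : State} {t : ℕ} :
      0 < s.reg r → Runs p s s' t → Runs (.ifPos r p q) s s' (t + 1)
  | ifFalse {r : ℕ} {p q : Prog} {s s' : State} {t : ℕ} :
      s.reg r = 0 → Runs q s s' t → Runs (.ifPos r p q) s s' (t + 1)
  | whileTrue {r : ℕ} {p : Prog} {s₁ s₂ s₃ : State} {t₁ t₂ : ℕ} :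
      0 < s₁.reg r → Runs p s₁ s₂ t₁ → Runs (.whilePos r p) s₂ s₃ t₂ →
      Runs (.whilePos r p) s₁ s₃ (t₁ + t₂ + 1)
  | whileFalse {r : ℕ} {p : Prog} {s : State} :
      s.reg r = 0 → Runs (.whilePos r p) s s 1

/-- The machine is deterministic. -/
theorem Runs.deterministic {p : Prog} {s s₁ : State} {t₁ : ℕ} (h₁ : Runs p s s₁ t₁) :
    ∀ {s₂ : State} {t₂ : ℕ}, Runs p s s₂ t₂ → s₁ = s₂ ∧ t₁ = t₂ := by
  induction h₁ with
  | const | add | sub | load | store => intro s₂ t₂ h; cases h; exact ⟨rfl, rfl⟩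
  | seq _ _ ih₁ ih₂ =>
    intro s₂ t₂ h
    cases h with
    | seq a b =>
      obtain ⟨rfl, rfl⟩ := ih₁ a
      obtain ⟨rfl, rfl⟩ := ih₂ b
      exact ⟨rfl, rfl⟩
  | ifTrue hr _ ih =>
    intro s₂ t₂ h
    cases h with
    | ifTrue _ a => obtain ⟨rfl, rfl⟩ := ih a; exact ⟨rfl, rfl⟩
    | ifFalse h0 _ => omega
  | ifFalse hr _ ih =>
    intro s₂ t₂ h
    cases h with
    | ifTrue h0 _ => omega
    | ifFalse _ a => obtain ⟨rfl, rfl⟩ := ih a; exact ⟨rfl, rfl⟩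
  | whileTrue hr _ _ ih₁ ih₂ =>
    intro s₂ t₂ h
    cases h with
    | whileTrue _ a b =>
      obtain ⟨rfl, rfl⟩ := ih₁ a
      obtain ⟨rfl, rfl⟩ := ih₂ b
      exact ⟨rfl, rfl⟩
    | whileFalse h0 => omega
  | whileFalse hr =>
    intro s₂ t₂ h
    cases h with
    | whileTrue h0 _ _ => omega
    | whileFalse _ => exact ⟨rfl, rfl⟩

/-- The initial state on input `G`: register `0` holds `n`, the memory cells `0, …, n² - 1` hold the
adjacency bits of `G` in row-by-row order, everything else is `0`. -/
def initState {n : ℕ} (G : PairGraph n) : State where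
  reg r := if r = 0 then n else 0
  mem a := if h : a < n * n then (G (finProdFinEquiv.symm ⟨a, h⟩)).toNat else 0

/-- The Boolean function `accept` of graphs is computed in polynomial time: a single program, on
every graph with `n` vertices, halts within `poly(n)` steps and leaves the value of `accept` in
register `0`. -/
def PolyTime (accept : (n : ℕ) → PairGraph n → Bool) : Prop :=
  ∃ (p : Prog) (B : Polynomial ℕ), ∀ (n : ℕ) (G : PairGraph n), ∃ (s : State) (t : ℕ),
    Runs p (initState G) s t ∧ t ≤ B.eval n ∧ s.reg 0 = (accept n G).toNat

/-! ### Certified counts -/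

/-- The bound on the number of `(1 - η)`-satisfying assignments. -/
noncomputable def countBound (n : ℕ) (η : ℝ) : ℝ :=
  if η ≤ 1 / (3 * (n : ℝ)) then 2 else 2 * Real.exp (3 * η * n * Real.log n)

/-- The value that a certification algorithm with the given verdict outputs for parameter `η`:
`countBound n η` if the verdict is to accept, and the trivial bound `2ⁿ` otherwise. -/
noncomputable def certifiedValue (verdict : Bool) (n : ℕ) (η : ℝ) : ℝ :=
  if verdict = true then countBound n η else 2 ^ n

end TwoXor

namespace TwoXor

/-! ### Arithmetic expressions computed by the machine in polynomial time -/

/-! The certificate expresses edge expansion, which controls all sign patterns at once. If two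
assignments differ exactly on S, then for any signs every edge across S is violated by one of them,
so at most 2η|G| edges cross. If each S with |S| ≤ n/2 has at least (5/6)|S||G|/n crossing edges
(`IsCertified.le_card_cut`), then |S| ≤ (12/5)ηn, after a global sign change if necessary. Counting
two Hamming balls bounds the number of solutions.

Expansion follows from a minimum degree condition and a spectral bound on the centred symmetrized
adjacency matrix D (`discMat`). Small entries of D^K, with K = 2^j, witness the spectral bound by
repeated Cauchy–Schwarz (`abs_quadForm_pow_mul_le`). This loses only a factor n^(1/K), affordable
for a constant K ≥ 8/δ. The verdict is therefore the value of a fixed arithmetic expression, and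
polynomial time follows from the closure of `PolyComputable` under arithmetic and bounded sums.

For the random graph, Bernstein's inequality and a union bound control the degrees and give
discrepancy at most α√(|S||T|), where α = n^(3δ/4) and the expected degree is n^δ. Binary digits of
integer vectors turn discrepancy into a bound on bilinear forms, at the cost of the number L = O(log
n) of digits (`abs_bilin_nat_le`). Applied along the vectors D^i e_v, this bounds the entries of D^K
without eigenvalues (`abs_pow_apply_le`). The gap n^(δ/4) between degree and discrepancy absorbs all
losses. -/

/-- The environment `env` with a new variable `0` of value `w`; the others are shifted. -/
def consEnv (w : ℕ) (env : ℕ → ℕ) : ℕ → ℕ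
  | 0 => w
  | i + 1 => env i

/-- A function of the size `n`, the memory and an environment is polynomially computable if,
wherever the variables sit among the registers below `d`, some program computes it into register
`d`, preserves the memory and the registers below `d`, and takes a number of steps that is
polynomial in the size and the variables (for memories holding bits).  The value must be bounded
by the same polynomial. -/
def PolyComputable (f : ℕ → (ℕ → ℕ) → (ℕ → ℕ) → ℕ) : Prop :=
  ∀ (d : ℕ) (σ : ℕ → ℕ), 0 < d → (∀ i, σ i < d) → ∃ (p : Prog) (B : Polynomial ℕ),
    ∀ (s : State) (X : ℕ), (∀ a, s.mem a ≤ 1) → s.reg 0 ≤ X → (∀ i, s.reg (σ i) ≤ X) →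
      f (s.reg 0) s.mem (fun i => s.reg (σ i)) ≤ B.eval X ∧
      ∃ (s' : State) (t : ℕ), Runs p s s' t ∧ t ≤ B.eval X ∧ s'.mem = s.mem ∧
        (∀ i < d, s'.reg i = s.reg i) ∧
        s'.reg d = f (s.reg 0) s.mem (fun i => s.reg (σ i))

@[simp] theorem State.setReg_mem (s : State) (d v : ℕ) : (s.setReg d v).mem = s.mem := rfl

theorem State.setReg_reg (s : State) (d v i : ℕ) :
    (s.setReg d v).reg i = if i = d then v else s.reg i := by
  simp [State.setReg, Function.update_apply]

namespace PolyComputable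

theorem const (c : ℕ) : PolyComputable fun _ _ _ => c := by
  intro d σ _ _
  refine ⟨.const d c, Polynomial.C (c + 1), fun s X _ _ _ => ⟨by simp, _, _, .const s d c, ?_, rfl,
    fun i hi => ?_, ?_⟩⟩
  · simp
  · rw [State.setReg_reg, if_neg hi.ne]
  · rw [State.setReg_reg, if_pos rfl]

/-- The machine has no move instruction, so `d` is cleared and `r` added; `r < d` protects the
source from being cleared. -/
theorem copyReg {d r : ℕ} (hr : r < d) (s : State) :
    ∃ s', Runs (.seq (.const d 0) (.add d d r)) s s' 2 ∧ s'.mem = s.mem ∧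
      (∀ i < d, s'.reg i = s.reg i) ∧ s'.reg d = s.reg r := by
  refine ⟨_, .seq (.const s d 0) (.add _ d d r), rfl, fun i hi => ?_, ?_⟩
  · simp [State.setReg_reg, hi.ne]
  · simp [State.setReg_reg, hr.ne]

theorem size : PolyComputable fun n _ _ => n := by
  intro d σ hd _
  refine ⟨.seq (.const d 0) (.add d d 0), Polynomial.X + Polynomial.C 2, fun s X _ h _ => ?_⟩
  obtain ⟨s', h1, h2, h3, h4⟩ := copyReg hd s
  exact ⟨by simp; omega, s', 2, h1, by simp, h2, h3, h4⟩

theorem var (j : ℕ) : PolyComputable fun _ _ env => env j := by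
  intro d σ _ hσ
  refine ⟨.seq (.const d 0) (.add d d (σ j)), Polynomial.X + Polynomial.C 2, fun s X _ _ h => ?_⟩
  obtain ⟨s', h1, h2, h3, h4⟩ := copyReg (hσ j) s
  exact ⟨by simpa using (h j).trans (Nat.le_add_right _ _), s', 2, h1, by simp, h2, h3, h4⟩

variable {f g : ℕ → (ℕ → ℕ) → (ℕ → ℕ) → ℕ}

theorem mem (hf : PolyComputable f) : PolyComputable fun n m env => m (f n m env) := by
  intro d σ hd hσ
  obtain ⟨p, B, h⟩ := hf d σ hd hσ
  refine ⟨.seq p (.load d d), B + Polynomial.C 1, fun s X hm h0 hX => ?_⟩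
  obtain ⟨-, s', t, hr, ht, hmem, hreg, hd'⟩ := h s X hm h0 hX
  refine ⟨by simpa using (hm _).trans (Nat.le_add_left _ _), _, _, .seq hr (.load s' d d), ?_, ?_,
    fun i hi => ?_, ?_⟩
  · simpa using ht
  · simpa using hmem
  · rw [State.setReg_reg, if_neg hi.ne, hreg i hi]
  · rw [State.setReg_reg, if_pos rfl, hd', hmem]

/-- The first operand waits in register `d` while the second is computed from `d + 1` upwards. The
hypothesis `hop` keeps values polynomial. -/
theorem binary (hf : PolyComputable f) (hg : PolyComputable g) (op : ℕ → ℕ → ℕ)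
    (hop : ∀ a b, op a b ≤ a + b) (I : ℕ → ℕ → ℕ → Prog)
    (hI : ∀ (s : State) (d a b : ℕ), Runs (I d a b) s (s.setReg d (op (s.reg a) (s.reg b))) 1) :
    PolyComputable fun n m env => op (f n m env) (g n m env) := by
  intro d σ hd hσ
  obtain ⟨p, B, h⟩ := hf d σ hd hσ
  obtain ⟨q, C, k⟩ := hg (d + 1) σ d.succ_pos fun i => (hσ i).trans d.lt_succ_self
  refine ⟨.seq p (.seq q (I d d (d + 1))), B + C + Polynomial.C 1, fun s X hm h0 hX => ?_⟩
  obtain ⟨hv, s₁, t₁, hr, ht, hmem, hreg, hd'⟩ := h s X hm h0 hX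
  have e1 : (fun i => s₁.reg (σ i)) = fun i => s.reg (σ i) := funext fun i => hreg _ (hσ i)
  obtain ⟨hv2, s₂, t₂, hr2, ht2, hmem2, hreg2, hd2⟩ := k s₁ X (by rwa [hmem])
    (by rwa [hreg 0 hd]) (fun i => by rw [hreg _ (hσ i)]; exact hX i)
  rw [e1, hmem, hreg 0 hd] at hv2 hd2
  refine ⟨?_, _, _, .seq hr (.seq hr2 (hI s₂ d d (d + 1))), ?_, ?_, fun i hi => ?_, ?_⟩
  · have := hop (f (s.reg 0) s.mem fun i => s.reg (σ i)) (g (s.reg 0) s.mem fun i => s.reg (σ i))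
    simp only [Polynomial.eval_add, Polynomial.eval_C]
    omega
  · simp only [Polynomial.eval_add, Polynomial.eval_C]
    omega
  · simp [hmem, hmem2]
  · rw [State.setReg_reg, if_neg hi.ne, hreg2 i (by omega), hreg i hi]
  · rw [State.setReg_reg, if_pos rfl, hd2, hreg2 d (by omega), hd']

theorem add (hf : PolyComputable f) (hg : PolyComputable g) :
    PolyComputable fun n m env => f n m env + g n m env :=
  binary hf hg (· + ·) (fun _ _ => le_rfl) .add .add

theorem sub (hf : PolyComputable f) (hg : PolyComputable g) :
    PolyComputable fun n m env => f n m env - g n m env :=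
  binary hf hg (· - ·) (fun _ _ => (Nat.sub_le _ _).trans (Nat.le_add_right _ _)) .sub .sub

/-- Weakening under a summation sign: the code generator is only given another placement of the
variables. -/
theorem shift (hf : PolyComputable f) : PolyComputable fun n m env => f n m fun i => env (i + 1) :=
  fun d σ hd hσ => by
    obtain ⟨p, B, h⟩ := hf d (fun i => σ (i + 1)) hd fun i => hσ _
    exact ⟨p, B, fun s X hm h0 hX => h s X hm h0 fun i => hX _⟩

/-- The body of the loop that computes a bounded sum: register `d` is the accumulator, `d + 1`
counts down, `d + 2` is the summation index. -/
def sumBody (d : ℕ) (q : Prog) : Prog :=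
  .seq q (.seq (.add d d (d + 3)) (.seq (.const (d + 3) 1)
    (.seq (.add (d + 2) (d + 2) (d + 3)) (.sub (d + 1) (d + 1) (d + 3)))))

theorem runs_sumBody {d : ℕ} {q : Prog} {s s₁ : State} {t : ℕ} (h : Runs q s s₁ t)
    (hm : s₁.mem = s.mem) (hr : ∀ i < d + 3, s₁.reg i = s.reg i) :
    ∃ s', Runs (sumBody d q) s s' (t + 4) ∧ s'.mem = s.mem ∧ (∀ i < d, s'.reg i = s.reg i) ∧
      s'.reg d = s.reg d + s₁.reg (d + 3) ∧ s'.reg (d + 1) = s.reg (d + 1) - 1 ∧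
      s'.reg (d + 2) = s.reg (d + 2) + 1 := by
  refine ⟨_, .seq h (.seq (.add _ _ _ _) (.seq (.const _ _ _) (.seq (.add _ _ _ _)
    (.sub _ _ _ _)))), ?_, fun i hi => ?_, ?_, ?_, ?_⟩
  · simpa using hm
  · have h1 : i ≠ d + 1 := by omega
    have h2 : i ≠ d + 2 := by omega
    have h3 : i ≠ d + 3 := by omega
    simp [State.setReg_reg, hi.ne, h1, h2, h3, hr i (by omega)]
  · simp [State.setReg_reg, hr d (by omega)]
  · simp [State.setReg_reg, hr (d + 1) (by omega)]
  · simp [State.setReg_reg, hr (d + 2) (by omega)]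

/-- Induction on the number `r` of remaining rounds. The invariant that index and counter add up to
`F` keeps the index below `F` whenever the body runs. -/
theorem runs_sumLoop {d : ℕ} {σ : ℕ → ℕ} {q : Prog} {T n : ℕ} {m env : ℕ → ℕ} (hd : 0 < d)
    (hσ : ∀ i, σ i < d) (F : ℕ)
    (hq : ∀ s : State, s.mem = m → s.reg 0 = n → (∀ i, s.reg (σ i) = env i) →
      s.reg (d + 2) < F → ∃ (s' : State) (t : ℕ), Runs q s s' t ∧ t ≤ T ∧ s'.mem = m ∧
        (∀ i < d + 3, s'.reg i = s.reg i) ∧ s'.reg (d + 3) = g n m (consEnv (s.reg (d + 2)) env))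
    (r : ℕ) : ∀ s : State, s.mem = m → s.reg 0 = n → (∀ i, s.reg (σ i) = env i) →
      s.reg (d + 1) = r → s.reg (d + 2) + r = F →
      ∃ (s' : State) (t : ℕ), Runs (.whilePos (d + 1) (sumBody d q)) s s' t ∧
        t ≤ r * (T + 5) + 1 ∧ s'.mem = m ∧ (∀ i < d, s'.reg i = s.reg i) ∧
        s'.reg d = s.reg d + ∑ j ∈ Finset.range r, g n m (consEnv (s.reg (d + 2) + j) env) := by
  induction r with
  | zero =>
    intro s hm _ _ h1 _
    exact ⟨s, 1, .whileFalse h1, by simp, hm, fun _ _ => rfl, by simp⟩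
  | succ r ih =>
    intro s hm h0 he h1 h2
    obtain ⟨s₁, t₁, hr1, ht1, hm1, hreg1, hd1⟩ := hq s hm h0 he (by omega)
    obtain ⟨s₂, hr2, hm2, hreg2, ha, hb, hc⟩ := runs_sumBody hr1 (hm1.trans hm.symm) hreg1
    obtain ⟨s₃, t₃, hr3, ht3, hm3, hreg3, hd3⟩ := ih s₂ (hm2.trans hm) ((hreg2 0 hd).trans h0)
      (fun i => (hreg2 _ (hσ i)).trans (he i)) (by omega) (by omega)
    refine ⟨s₃, _, .whileTrue (by omega) hr2 hr3, ?_, hm3,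
      fun i hi => (hreg3 i hi).trans (hreg2 i hi), ?_⟩
    · have : (r + 1) * (T + 5) = r * (T + 5) + T + 5 := by ring
      omega
    · rw [hd3, ha, hd1, hc, Finset.sum_range_succ', add_zero]
      simp only [add_assoc, add_comm 1]
      rw [add_comm (g n m _)]

theorem sum (hf : PolyComputable f) (hg : PolyComputable g) :
    PolyComputable fun n m env => ∑ w ∈ Finset.range (f n m env), g n m (consEnv w env) := by
  intro d σ hd hσ
  obtain ⟨p, B, h⟩ := hf (d + 1) σ d.succ_pos fun i => (hσ i).trans d.lt_succ_self
  obtain ⟨q, C, k⟩ := hg (d + 3) (consEnv (d + 2) σ) (by omega) fun i => by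
    cases i with
    | zero => exact Nat.lt_succ_self _
    | succ i => exact (hσ i).trans (by omega)
  refine ⟨.seq p (.seq (.const d 0) (.seq (.const (d + 2) 0) (.whilePos (d + 1) (sumBody d q)))),
    -- The body sees the index as a variable of size up to `B`, hence the composition. The 5 pays
    -- for four bookkeeping instructions and a test per round, the 3 for two initializations and the
    -- final test.
    B + B * (C.comp (Polynomial.X + B) + Polynomial.C 5) + Polynomial.C 3,
    fun s X hm h0 hX => ?_⟩
  obtain ⟨hv, s₁, t₁, hr, ht, hmem, hreg, hd'⟩ := h s X hm h0 hX
  set F := f (s.reg 0) s.mem fun i => s.reg (σ i) with hF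
  have key : ∀ s₂ : State, s₂.mem = s.mem → s₂.reg 0 = s.reg 0 →
      (∀ i, s₂.reg (σ i) = s.reg (σ i)) → s₂.reg (d + 2) < F →
      g (s.reg 0) s.mem (consEnv (s₂.reg (d + 2)) fun i => s.reg (σ i)) ≤
        C.eval (X + B.eval X) ∧
      ∃ (s' : State) (t : ℕ), Runs q s₂ s' t ∧ t ≤ C.eval (X + B.eval X) ∧ s'.mem = s.mem ∧
        (∀ i < d + 3, s'.reg i = s₂.reg i) ∧
        s'.reg (d + 3) = g (s.reg 0) s.mem
          (consEnv (s₂.reg (d + 2)) fun i => s.reg (σ i)) := by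
    intro s₂ hm2 h02 he2 hlt
    have e1 : (fun i => s₂.reg (consEnv (d + 2) σ i)) =
        consEnv (s₂.reg (d + 2)) fun i => s.reg (σ i) := by
      funext i
      cases i with
      | zero => rfl
      | succ i => exact he2 i
    have := k s₂ (X + B.eval X) (by rwa [hm2]) (by omega) fun i => by
      cases i with
      | zero => change s₂.reg (d + 2) ≤ _; omega
      | succ i =>
        change s₂.reg (σ i) ≤ _
        rw [he2]
        exact (hX i).trans (Nat.le_add_right _ _)
    rw [e1, hm2, h02] at this
    exact this
  set s₂ := (s₁.setReg d 0).setReg (d + 2) 0 with hs2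
  have r2 : ∀ i < d, s₂.reg i = s.reg i := fun i hi => by
    have h2 : i ≠ d + 2 := by omega
    simp [hs2, State.setReg_reg, hi.ne, h2, hreg i (by omega)]
  obtain ⟨s₃, t₃, hr3, ht3, hm3, hreg3, hd3⟩ := runs_sumLoop (g := g) hd hσ F
    (fun s₂ a b c e => (key s₂ a b c e).2) F s₂ (by simpa [hs2] using hmem)
    (r2 0 hd) (fun i => r2 _ (hσ i)) (by simp [hs2, State.setReg_reg, hd'])
    (by simp [hs2, State.setReg_reg])
  refine ⟨?_, s₃, _, .seq hr (.seq (.const _ _ _) (.seq (.const _ _ _) hr3)), ?_, hm3,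
    fun i hi => (hreg3 i hi).trans (r2 i hi), ?_⟩
  · have h1 : ∀ w ∈ Finset.range F, g (s.reg 0) s.mem (consEnv w fun i => s.reg (σ i)) ≤
        C.eval (X + B.eval X) := fun w hw => by
      have h2 : ∀ i < d, (s.setReg (d + 2) w).reg i = s.reg i := fun i hi => by
        rw [State.setReg_reg, if_neg (by omega)]
      have := (key (s.setReg (d + 2) w) rfl (h2 0 hd) (fun i => h2 _ (hσ i))
        (by simpa [State.setReg_reg] using hw)).1
      simpa [State.setReg_reg] using this
    have h2 := Finset.sum_le_card_nsmul _ _ _ h1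
    simp only [Finset.card_range, smul_eq_mul] at h2
    have h3 : F * C.eval (X + B.eval X) ≤ B.eval X * (C.eval (X + B.eval X) + 5) :=
      Nat.mul_le_mul hv (Nat.le_add_right _ _)
    simp only [Polynomial.eval_add, Polynomial.eval_mul, Polynomial.eval_comp, Polynomial.eval_X,
      Polynomial.eval_C]
    change (∑ w ∈ Finset.range F, g (s.reg 0) s.mem (consEnv w fun i => s.reg (σ i))) ≤ _
    omega
  · have h3 : F * (C.eval (X + B.eval X) + 5) ≤ B.eval X * (C.eval (X + B.eval X) + 5) :=
      Nat.mul_le_mul_right _ hv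
    simp only [Polynomial.eval_add, Polynomial.eval_mul, Polynomial.eval_comp, Polynomial.eval_X,
      Polynomial.eval_C]
    omega
  · rw [hd3]
    simp [hs2, State.setReg_reg]
    rfl

/-- Multiplication is repeated addition, with a summand that ignores the index; it is fast enough
because values are polynomially bounded. -/
theorem mul (hf : PolyComputable f) (hg : PolyComputable g) :
    PolyComputable fun n m env => f n m env * g n m env := by
  have := sum hf hg.shift
  simpa [consEnv] using this

theorem pow (hf : PolyComputable f) (k : ℕ) : PolyComputable fun n m env => f n m env ^ k := by
  induction k with
  | zero => simpa using const 1
  | succ k ih => simpa [pow_succ] using ih.mul hf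

end PolyComputable

theorem polyTime_of_polyComputable {V : ℕ → (ℕ → ℕ) → ℕ}
    (hV : PolyComputable fun n m _ => V n m) :
    PolyTime fun n G => decide (V n (initState G).mem = 0) := by
  obtain ⟨p, B, h⟩ := hV 1 (fun _ => 0) one_pos fun _ => one_pos
  -- The truncated difference 1 - V is 1 if V = 0 and 0 otherwise.
  refine ⟨.seq p (.seq (.const 2 1) (.sub 0 2 1)), B + Polynomial.C 2, fun n G => ?_⟩
  obtain ⟨-, s, t, hr, ht, hm, hreg, h1⟩ := h (initState G) n (fun a => by
      simp only [initState]
      split_ifs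
      · exact Bool.toNat_le _
      · exact Nat.zero_le _) le_rfl (fun i => le_rfl)
  refine ⟨_, _, .seq hr (.seq (.const s 2 1) (.sub _ 0 2 1)), ?_, ?_⟩
  · simp only [Polynomial.eval_add, Polynomial.eval_C]; omega
  · have : (initState G).reg 0 = n := rfl
    rw [this] at h1
    simp only [State.setReg_reg]
    simp only [if_true, OfNat.one_ne_ofNat, if_false, h1]
    by_cases hz : V n (initState G).mem = 0
    · simp [hz]
    · simp [hz]; omega

end TwoXor

namespace TwoXor

/-! ### The certificate -/

section Certificate

variable {n : ℕ}

/-- The adjacency matrix of a graph, with integer entries. -/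
def adjMat (G : PairGraph n) : Matrix (Fin n) (Fin n) ℤ :=
  Matrix.of fun u v => if G (u, v) = true then 1 else 0

/-- The symmetrized adjacency matrix minus its average entry, scaled to have integer entries. -/
def discMat (G : PairGraph n) : Matrix (Fin n) (Fin n) ℤ :=
  Matrix.of fun u v => (n : ℤ) ^ 2 * (adjMat G u v + adjMat G v u) - 2 * (edges G).card

/-- The certificate: the degrees are not much below average, and the entries of the power
`2 ^ j` of the discrepancy matrix are small. -/
def IsCertified (j : ℕ) (G : PairGraph n) : Prop :=
  4 ≤ n ∧ 0 < (edges G).card ∧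
  (∀ u, (46 : ℤ) * (edges G).card ≤ 24 * n * ∑ v, (adjMat G u v + adjMat G v u)) ∧
  ∀ u v, (24 : ℤ) ^ 2 ^ j * n * |(discMat G ^ 2 ^ j) u v| ≤ (2 * n * (edges G).card) ^ 2 ^ j

end Certificate

/-! ### The certificate as an arithmetic expression -/

/-- The adjacency bit of `(u, v)` in the memory. -/
def adjAt (n : ℕ) (m : ℕ → ℕ) (u v : ℕ) : ℕ := m (v + n * u)

/-- The number of edges of the graph in the memory. -/
def edgeCount (n : ℕ) (m : ℕ → ℕ) : ℕ :=
  ∑ u ∈ Finset.range n, ∑ v ∈ Finset.range n, adjAt n m u v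

/-- The entry `(u, v)` of the power `2 ^ j` of the discrepancy matrix, as a difference of two
natural numbers. -/
def powAt (n : ℕ) (m : ℕ → ℕ) : ℕ → Bool → ℕ → ℕ → ℕ
  | 0, true, u, v => n ^ 2 * (adjAt n m u v + adjAt n m v u)
  | 0, false, _, _ => 2 * edgeCount n m
  | j + 1, true, u, v => ∑ w ∈ Finset.range n,
      (powAt n m j true u w * powAt n m j true w v + powAt n m j false u w * powAt n m j false w v)
  | j + 1, false, u, v => ∑ w ∈ Finset.range n,
      (powAt n m j true u w * powAt n m j false w v + powAt n m j false u w * powAt n m j true w v)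

/-- The amount by which the inequalities of the certificate are violated. -/
def violation (j n : ℕ) (m : ℕ → ℕ) : ℕ :=
  (4 - n) + (1 - edgeCount n m) +
  (∑ u ∈ Finset.range n,
    (46 * edgeCount n m - 24 * n * ∑ v ∈ Finset.range n, (adjAt n m u v + adjAt n m v u))) +
  ∑ u ∈ Finset.range n, ∑ v ∈ Finset.range n,
    ((24 ^ 2 ^ j * n * powAt n m j true u v -
        (24 ^ 2 ^ j * n * powAt n m j false u v + (2 * n * edgeCount n m) ^ 2 ^ j)) +
      (24 ^ 2 ^ j * n * powAt n m j false u v -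
        (24 ^ 2 ^ j * n * powAt n m j true u v + (2 * n * edgeCount n m) ^ 2 ^ j)))

/-- A matrix depending on the size and the memory, all of whose entries are polynomially
computable. -/
def MatComputable (F : ℕ → (ℕ → ℕ) → ℕ → ℕ → ℕ) : Prop :=
  ∀ a b : ℕ → (ℕ → ℕ) → (ℕ → ℕ) → ℕ, PolyComputable a → PolyComputable b →
    PolyComputable fun n m env => F n m (a n m env) (b n m env)

open PolyComputable

theorem matComputable_adjAt : MatComputable adjAt := fun _ _ ha hb =>
  mem (add hb (mul size ha))

theorem polyComputable_edgeCount : PolyComputable fun n m _ => edgeCount n m :=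
  sum size (sum size (matComputable_adjAt _ _ (var 1) (var 0)))

theorem MatComputable.mulSum {F F' H H' : ℕ → (ℕ → ℕ) → ℕ → ℕ → ℕ} (hF : MatComputable F)
    (hF' : MatComputable F') (hH : MatComputable H) (hH' : MatComputable H') :
    MatComputable fun n m u v => ∑ w ∈ Finset.range n,
      (F n m u w * F' n m w v + H n m u w * H' n m w v) := fun _ _ ha hb =>
  sum size (add (mul (hF _ _ ha.shift (var 0)) (hF' _ _ (var 0) hb.shift))
    (mul (hH _ _ ha.shift (var 0)) (hH' _ _ (var 0) hb.shift)))

theorem matComputable_powAt (j : ℕ) : ∀ b, MatComputable fun n m => powAt n m j b := by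
  induction j with
  | zero =>
    rintro (_ | _)
    · exact fun _ _ _ _ => mul (const 2) polyComputable_edgeCount
    · exact fun _ _ ha hb => mul (pow size 2)
        (add (matComputable_adjAt _ _ ha hb) (matComputable_adjAt _ _ hb ha))
  | succ j ih =>
    rintro (_ | _)
    · exact (ih true).mulSum (ih false) (ih false) (ih true)
    · exact (ih true).mulSum (ih true) (ih false) (ih false)

theorem polyComputable_violation (j : ℕ) : PolyComputable fun n m _ => violation j n m := by
  have hD : PolyComputable fun n m _ => (2 * n * edgeCount n m) ^ 2 ^ j :=
    pow (mul (mul (const 2) size) polyComputable_edgeCount) _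
  have hP : ∀ b, PolyComputable fun n m env => 24 ^ 2 ^ j * n * powAt n m j b (env 1) (env 0) :=
    fun b => mul (mul (const _) size) (matComputable_powAt j b _ _ (var 1) (var 0))
  have h3 : PolyComputable fun n m env => 46 * edgeCount n m -
      24 * n * ∑ v ∈ Finset.range n, (adjAt n m (env 0) v + adjAt n m v (env 0)) :=
    sub (mul (const 46) polyComputable_edgeCount) (mul (mul (const 24) size)
      (sum size (add (matComputable_adjAt _ _ (var 1) (var 0))
        (matComputable_adjAt _ _ (var 0) (var 1)))))
  exact add (add (add (sub (const 4) size) (sub (const 1) polyComputable_edgeCount))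
    (sum size h3)) (sum size (sum size (add (sub (hP true) (add (hP false) hD))
      (sub (hP false) (add (hP true) hD)))))

/-! ### Correctness of the arithmetic expression -/

section Meaning

variable {n : ℕ} (G : PairGraph n)

theorem adjAt_initState (u v : Fin n) :
    (adjAt n (initState G).mem u v : ℤ) = adjMat G u v := by
  have h : (v : ℕ) + n * u < n * n := (finProdFinEquiv (u, v)).2
  have e : finProdFinEquiv.symm ⟨(v : ℕ) + n * u, h⟩ = (u, v) := by
    rw [Equiv.symm_apply_eq]; rfl
  simp only [adjAt, initState, h, dif_pos, e, adjMat, Matrix.of_apply]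
  cases G (u, v) <;> rfl

theorem sum_adjMat : ∑ u, ∑ v, adjMat G u v = (edges G).card := by
  have : ∑ e : Fin n × Fin n, adjMat G e.1 e.2 = (edges G).card := by simp [adjMat, edges]
  rwa [Fintype.sum_prod_type] at this

theorem edgeCount_initState : edgeCount n (initState G).mem = (edges G).card := by
  have : (edgeCount n (initState G).mem : ℤ) = (edges G).card := by
    rw [← sum_adjMat, edgeCount, Finset.sum_range]
    push_cast
    refine Finset.sum_congr rfl fun u _ => ?_
    rw [Finset.sum_range]
    exact Finset.sum_congr rfl fun v _ => adjAt_initState G u v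
  exact_mod_cast this

/-- Repeated squaring with separated signs: (P - Q)² = (PP + QQ) - (PQ + QP). -/
theorem powAt_initState (j : ℕ) (u v : Fin n) :
    (powAt n (initState G).mem j true u v : ℤ) - powAt n (initState G).mem j false u v =
      (discMat G ^ 2 ^ j) u v := by
  induction j generalizing u v with
  | zero =>
    simp only [powAt, discMat, pow_zero, pow_one, Matrix.of_apply, edgeCount_initState]
    push_cast
    rw [adjAt_initState, adjAt_initState]
  | succ j ih =>
    rw [pow_succ, pow_mul, pow_two, Matrix.mul_apply]
    simp only [powAt, Finset.sum_range, ← ih]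
    push_cast
    rw [← Finset.sum_sub_distrib]
    exact Finset.sum_congr rfl fun w _ => by ring

/-- A sum of truncated differences vanishes only if every inequality holds; the two mirrored
differences per entry encode the absolute value. -/
theorem violation_eq_zero_iff (j : ℕ) :
    violation j n (initState G).mem = 0 ↔ IsCertified j G := by
  simp only [violation, edgeCount_initState, Finset.sum_range, Nat.add_eq_zero_iff,
    Finset.sum_eq_zero_iff, Finset.mem_univ, true_imp_iff, Nat.sub_eq_zero_iff_le, IsCertified,
    and_assoc, Nat.one_le_iff_ne_zero, pos_iff_ne_zero]
  refine and_congr Iff.rfl (and_congr Iff.rfl (and_congr (forall_congr' fun u => ?_)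
    (forall_congr' fun u => forall_congr' fun v => ?_)))
  · zify
    simp only [adjAt_initState]
  · zify
    rw [← powAt_initState, ← abs_of_nonneg (show (0 : ℤ) ≤ 24 ^ 2 ^ j * n by positivity),
      ← abs_mul, abs_of_nonneg (show (0 : ℤ) ≤ 24 ^ 2 ^ j * n by positivity), abs_le, mul_sub]
    constructor
    · rintro ⟨h1, h2⟩
      constructor <;> linarith
    · rintro ⟨h1, h2⟩
      constructor <;> linarith

/-- Whether the graph in the memory has a certificate is decided in polynomial time. -/
theorem polyTime_isCertified (j : ℕ) [∀ n (G : PairGraph n), Decidable (IsCertified j G)] :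
    PolyTime fun _ G => decide (IsCertified j G) := by
  have := polyTime_of_polyComputable (polyComputable_violation j)
  simpa only [violation_eq_zero_iff] using this

end Meaning

end TwoXor

namespace TwoXor

/-! ### Certified graphs expand -/

section Soundness

open Matrix

variable {n : ℕ}

theorem sq_dotProduct_le (f g : Fin n → ℤ) : (f ⬝ᵥ g) ^ 2 ≤ (f ⬝ᵥ f) * (g ⬝ᵥ g) := by
  simpa only [dotProduct, sq] using Finset.sum_mul_sq_le_sq_mul_sq Finset.univ f g

/-- The power method for the quadratic form of a symmetric matrix. -/
theorem abs_quadForm_pow_mul_le {N : Matrix (Fin n) (Fin n) ℤ} (hN : N.IsSymm) (f : Fin n → ℤ)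
    (j : ℕ) : |f ⬝ᵥ N *ᵥ f| ^ 2 ^ j * (f ⬝ᵥ f) ≤ (f ⬝ᵥ f) ^ 2 ^ j * |f ⬝ᵥ (N ^ 2 ^ j) *ᵥ f| := by
  have hs : 0 ≤ f ⬝ᵥ f := Finset.sum_nonneg fun i _ => mul_self_nonneg _
  induction j with
  | zero => simp [mul_comm]
  | succ j ih =>
    rcases hs.eq_or_lt with h0 | hpos
    · simp [← h0]
    have hsym : (N ^ 2 ^ j).IsSymm := hN.pow _
    -- By symmetry the form of the doubled power is a squared norm, so Cauchy–Schwarz against `f`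
    -- bounds the square of the previous form. Squaring the induction hypothesis then doubles the
    -- exponent.
    have h1 : f ⬝ᵥ (N ^ 2 ^ (j + 1)) *ᵥ f = (N ^ 2 ^ j) *ᵥ f ⬝ᵥ (N ^ 2 ^ j) *ᵥ f := by
      rw [pow_succ 2 j, pow_mul, sq, ← mulVec_mulVec, dotProduct_mulVec, ← mulVec_transpose,
        hsym.eq]
    have h2 := sq_dotProduct_le f ((N ^ 2 ^ j) *ᵥ f)
    rw [← h1, ← sq_abs] at h2
    have h3 : (|f ⬝ᵥ N *ᵥ f| ^ 2 ^ j * (f ⬝ᵥ f)) ^ 2 ≤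
        ((f ⬝ᵥ f) ^ 2 ^ j * |f ⬝ᵥ (N ^ 2 ^ j) *ᵥ f|) ^ 2 :=
      pow_le_pow_left₀ (by positivity) ih 2
    refine le_of_mul_le_mul_right ?_ hpos
    calc |f ⬝ᵥ N *ᵥ f| ^ 2 ^ (j + 1) * (f ⬝ᵥ f) * (f ⬝ᵥ f)
        = (|f ⬝ᵥ N *ᵥ f| ^ 2 ^ j * (f ⬝ᵥ f)) ^ 2 := by rw [pow_succ 2 j, pow_mul]; ring
      _ ≤ _ := h3
      _ = (f ⬝ᵥ f) ^ 2 ^ (j + 1) * |f ⬝ᵥ (N ^ 2 ^ j) *ᵥ f| ^ 2 := by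
        rw [pow_succ 2 j, pow_mul]; ring
      _ ≤ (f ⬝ᵥ f) ^ 2 ^ (j + 1) * ((f ⬝ᵥ f) * |f ⬝ᵥ (N ^ 2 ^ (j + 1)) *ᵥ f|) :=
        mul_le_mul_of_nonneg_left
          (h2.trans (mul_le_mul_of_nonneg_left (le_abs_self _) hs)) (by positivity)
      _ = _ := by ring

theorem indicator_dotProduct (S T : Finset (Fin n)) (M : Matrix (Fin n) (Fin n) ℤ) :
    (fun u => if u ∈ S then 1 else 0) ⬝ᵥ M *ᵥ (fun v => if v ∈ T then 1 else 0) =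
      ∑ u ∈ S, ∑ v ∈ T, M u v := by
  simp [dotProduct, mulVec]

theorem discMat_isSymm (G : PairGraph n) : (discMat G).IsSymm := by
  ext u v
  simp [discMat, add_comm]

variable {j : ℕ} {G : PairGraph n}

/-- The power method for the indicator of `S`: the entry bound is summed over |S|² entries, one
factor |S| ≤ n cancels the `n` in the certificate, and K-th roots are taken. -/
theorem IsCertified.sum_discMat_le (h : IsCertified j G) (S : Finset (Fin n)) :
    12 * ∑ u ∈ S, ∑ v ∈ S, discMat G u v ≤ n * (edges G).card * S.card := by
  obtain ⟨hn, he, -, hH⟩ := h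
  rcases S.eq_empty_or_nonempty with rfl | hS
  · simp
  set f : Fin n → ℤ := fun u => if u ∈ S then 1 else 0 with hf
  set K := 2 ^ j with hK
  set e : ℤ := ((edges G).card : ℤ)
  have hs0 : (0 : ℤ) < S.card := by exact_mod_cast hS.card_pos
  have hsn : (S.card : ℤ) ≤ n := by exact_mod_cast (card_finset_fin_le S)
  have hff : f ⬝ᵥ f = S.card := by simp [dotProduct, hf]
  have key := abs_quadForm_pow_mul_le (discMat_isSymm G) f j
  rw [hff, indicator_dotProduct, indicator_dotProduct, ← hK] at key
  set a := ∑ u ∈ S, ∑ v ∈ S, discMat G u v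
  have hb : 24 ^ K * n * |∑ u ∈ S, ∑ v ∈ S, (discMat G ^ K) u v| ≤
      S.card * (S.card * (2 * n * e) ^ K) := by
    calc 24 ^ K * (n : ℤ) * |∑ u ∈ S, ∑ v ∈ S, (discMat G ^ K) u v|
        ≤ 24 ^ K * (n : ℤ) * ∑ u ∈ S, ∑ v ∈ S, |(discMat G ^ K) u v| := by
          gcongr
          exact (Finset.abs_sum_le_sum_abs _ _).trans
            (Finset.sum_le_sum fun u _ => Finset.abs_sum_le_sum_abs _ _)
      _ = ∑ u ∈ S, ∑ v ∈ S, 24 ^ K * (n : ℤ) * |(discMat G ^ K) u v| := by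
          simp only [Finset.mul_sum]
      _ ≤ ∑ u ∈ S, ∑ v ∈ S, (2 * n * e) ^ K :=
          Finset.sum_le_sum fun u _ => Finset.sum_le_sum fun v _ => hH u v
      _ = _ := by simp
  have hfin : (24 * |a|) ^ K ≤ (2 * n * e * S.card) ^ K := by
    have hn0 : (0 : ℤ) < n := by exact_mod_cast (by omega : 0 < n)
    refine le_of_mul_le_mul_right (a := (n : ℤ) * S.card) ?_ (by positivity)
    calc (24 * |a|) ^ K * (n * S.card) = 24 ^ K * n * (|a| ^ K * S.card) := by
          rw [mul_pow]; ring
      _ ≤ 24 ^ K * n * (S.card ^ K * |∑ u ∈ S, ∑ v ∈ S, (discMat G ^ K) u v|) := by gcongr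
      _ = S.card ^ K * (24 ^ K * n * |∑ u ∈ S, ∑ v ∈ S, (discMat G ^ K) u v|) := by ring
      _ ≤ S.card ^ K * (S.card * (S.card * (2 * n * e) ^ K)) := by gcongr
      _ ≤ S.card ^ K * (S.card * (n * (2 * n * e) ^ K)) := by gcongr
      _ = _ := by rw [mul_pow _ (S.card : ℤ)]; ring
  have h2 := le_of_pow_le_pow_left₀ (by positivity) (by positivity) hfin
  have := le_abs_self a
  linarith

/-- The edges between a vertex set and its complement. -/
def cut (G : PairGraph n) (S : Finset (Fin n)) : Finset (Fin n × Fin n) :=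
  (edges G).filter fun e => ¬(e.1 ∈ S ↔ e.2 ∈ S)

/-- The degrees of `S` count a crossing edge once and an inner edge twice; the subtracted sum counts
inner edges twice as well. -/
theorem card_cut (G : PairGraph n) (S : Finset (Fin n)) :
    ((cut G S).card : ℤ) = ∑ u ∈ S, ∑ v, (adjMat G u v + adjMat G v u) -
      ∑ u ∈ S, ∑ v ∈ S, (adjMat G u v + adjMat G v u) := by
  have h1 : ((cut G S).card : ℤ) =
      ∑ u, ∑ v, if ¬(u ∈ S ↔ v ∈ S) then adjMat G u v else 0 := by
    have : ∑ e : Fin n × Fin n, (if ¬(e.1 ∈ S ↔ e.2 ∈ S) then adjMat G e.1 e.2 else 0) =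
        (cut G S).card := by
      simp only [cut, edges, adjMat, Finset.filter_filter, of_apply, ← ite_and, Finset.sum_boole]
      congr 2
      ext e
      simp [and_comm]
    rw [Fintype.sum_prod_type] at this
    exact this.symm
  have h2 : ∑ u ∈ S, ∑ v, (adjMat G u v + adjMat G v u) =
      ∑ u, ∑ v, ((if u ∈ S then adjMat G u v else 0) + if v ∈ S then adjMat G u v else 0) := by
    simp only [Finset.sum_add_distrib]
    congr 1
    · simp
    · rw [Finset.sum_comm]; simp
  have h3 : ∑ u ∈ S, ∑ v ∈ S, (adjMat G u v + adjMat G v u) =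
      ∑ u, ∑ v, if u ∈ S ∧ v ∈ S then 2 * adjMat G u v else 0 := by
    simp only [Finset.sum_add_distrib]
    rw [Finset.sum_comm (f := fun u v => adjMat G v u), ← two_mul]
    simp [ite_and, Finset.mul_sum]
  rw [h1, h2, h3, ← Finset.sum_sub_distrib]
  refine Finset.sum_congr rfl fun u _ => ?_
  rw [← Finset.sum_sub_distrib]
  refine Finset.sum_congr rfl fun v _ => ?_
  by_cases hu : u ∈ S <;> by_cases hv : v ∈ S <;> (simp [hu, hv]; try ring)

/-- Certified graphs are good edge expanders. -/
theorem IsCertified.le_card_cut (h : IsCertified j G) {S : Finset (Fin n)} (hS : 2 * S.card ≤ n) :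
    5 * (S.card * (edges G).card) ≤ 6 * n * (cut G S).card := by
  have hd := h.sum_discMat_le S
  obtain ⟨hn, he, hdeg, -⟩ := h
  have hn0 : (0 : ℤ) < n := by exact_mod_cast (by omega : 0 < n)
  have hc := card_cut G S
  have h1 : ∑ u ∈ S, ∑ v ∈ S, discMat G u v =
      n ^ 2 * ∑ u ∈ S, ∑ v ∈ S, (adjMat G u v + adjMat G v u) -
        2 * (edges G).card * S.card * S.card := by
    simp only [discMat, of_apply, Finset.sum_sub_distrib, Finset.mul_sum, Finset.sum_const,
      nsmul_eq_mul]
    ring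
  have h2 : (S.card : ℤ) * (46 * (edges G).card) ≤
      24 * n * ∑ u ∈ S, ∑ v, (adjMat G u v + adjMat G v u) := by
    rw [Finset.mul_sum, ← nsmul_eq_mul]
    exact Finset.card_nsmul_le_sum _ _ _ fun u _ => hdeg u
  set D := ∑ u ∈ S, ∑ v, (adjMat G u v + adjMat G v u)
  set I := ∑ u ∈ S, ∑ v ∈ S, (adjMat G u v + adjMat G v u)
  have hS' : 2 * (S.card : ℤ) ≤ n := by exact_mod_cast hS
  -- In units of |S||G|/n, the degrees give 46/24. Inner edges take at most 13/12: 1 from the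
  -- density, using |S| ≤ n/2, and 1/12 from the discrepancy. What remains is 5/6.
  have h3 : 12 * (n : ℤ) ^ 2 * I ≤ 12 * n * ((edges G).card * S.card) +
      n * ((edges G).card * S.card) := by
    have : (2 * (S.card : ℤ)) * ((edges G).card * S.card) ≤ n * ((edges G).card * S.card) := by
      gcongr
    rw [h1] at hd
    linarith
  have h4 : 12 * (n : ℤ) * I ≤ 13 * ((edges G).card * S.card) := by
    refine le_of_mul_le_mul_left ?_ hn0
    linarith
  have : 5 * ((S.card : ℤ) * (edges G).card) ≤ 6 * n * (cut G S).card := by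
    rw [hc, mul_sub]
    linarith
  exact_mod_cast this

/-! ### Approximate solutions on certified graphs -/

theorem satisfied_neg (b : Signing n) (x : Assignment n) : satisfied G b (-x) = satisfied G b x := by
  simp [satisfied]

theorem IsApproxSat.neg {b : Signing n} {η : ℝ} {x : Assignment n} (h : IsApproxSat G b η x) :
    IsApproxSat G b η (-x) := by
  rwa [IsApproxSat, satisfied_neg]

theorem hammingDist_neg_add (x x' : Assignment n) :
    hammingDist x' (-x) + hammingDist x' x = n := by
  have h : ∀ i, x' i ≠ (-x) i ↔ ¬ x' i ≠ x i := fun i => by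
    rcases Int.units_eq_one_or (x' i) with h | h <;>
      rcases Int.units_eq_one_or (x i) with h' | h' <;> simp [h, h']
  simp only [hammingDist, h]
  rw [add_comm, Finset.card_filter_add_card_filter_not]
  simp

/-- On an edge leaving the set where `x` and `x'` differ, exactly one endpoint flips, so the two
products disagree and one constraint fails. The resulting bound 2η|G| on the cut is compared with
expansion. -/
theorem IsCertified.hammingDist_le (h : IsCertified j G) {b : Signing n} {η : ℝ}
    {x x' : Assignment n} (hx : IsApproxSat G b η x) (hx' : IsApproxSat G b η x')
    (hd : 2 * hammingDist x' x ≤ n) : (hammingDist x' x : ℝ) ≤ 12 / 5 * (η * n) := by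
  classical
  set S : Finset (Fin n) := Finset.univ.filter fun i => x' i ≠ x i with hS
  have hSd : S.card = hammingDist x' x := rfl
  have hcut : cut G S ⊆ (edges G \ satisfied G b x) ∪ (edges G \ satisfied G b x') := by
    intro e he
    simp only [cut, Finset.mem_filter] at he
    obtain ⟨he, hne⟩ := he
    by_contra hcon
    simp only [satisfied, Finset.mem_union, Finset.mem_sdiff, Finset.mem_filter, he, true_and,
      not_or, not_not] at hcon
    apply hne
    simp only [hS, Finset.mem_filter, Finset.mem_univ, true_and]
    have h3 := hcon.1.trans hcon.2.symm
    rcases Int.units_eq_one_or (x e.1) with h1 | h1 <;>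
      rcases Int.units_eq_one_or (x e.2) with h2 | h2 <;>
      rcases Int.units_eq_one_or (x' e.1) with h1' | h1' <;>
      rcases Int.units_eq_one_or (x' e.2) with h2' | h2' <;>
      simp_all
  have hunsat : ∀ y, IsApproxSat G b η y →
      ((edges G \ satisfied G b y).card : ℝ) ≤ η * (edges G).card := fun y hy => by
    have : satisfied G b y ⊆ edges G := Finset.filter_subset _ _
    rw [Finset.card_sdiff_of_subset this, Nat.cast_sub (Finset.card_le_card this)]
    have : (1 - η) * ((edges G).card : ℝ) ≤ ((satisfied G b y).card : ℝ) := hy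
    linarith
  have h1 : ((cut G S).card : ℝ) ≤ 2 * η * (edges G).card := by
    have : ((cut G S).card : ℝ) ≤ ((edges G \ satisfied G b x).card : ℝ) +
        ((edges G \ satisfied G b x').card : ℝ) := by
      exact_mod_cast (Finset.card_le_card hcut).trans (Finset.card_union_le _ _)
    have := hunsat x hx
    have := hunsat x' hx'
    linarith
  have h2 : 5 * ((S.card : ℝ) * (edges G).card) ≤ 6 * n * (cut G S).card := by
    exact_mod_cast h.le_card_cut (S := S) hd
  have he : (0 : ℝ) < (edges G).card := by exact_mod_cast h.2.1
  rw [← hSd]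
  refine le_of_mul_le_mul_right ?_ he
  have : 6 * (n : ℝ) * (cut G S).card ≤ 6 * n * (2 * η * (edges G).card) := by gcongr
  linarith

theorem IsCertified.hammingDist_le_or (h : IsCertified j G) {b : Signing n} {η : ℝ}
    {x x' : Assignment n} (hx : IsApproxSat G b η x) (hx' : IsApproxSat G b η x') :
    (hammingDist x' x : ℝ) ≤ 12 / 5 * (η * n) ∨ (hammingDist x' (-x) : ℝ) ≤ 12 / 5 * (η * n) := by
  have := hammingDist_neg_add x x'
  rcases le_total (2 * hammingDist x' x) n with h1 | h1
  · exact .inl (h.hammingDist_le hx hx' h1)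
  · exact .inr (h.hammingDist_le hx.neg hx' (by omega))

/-! ### Counting -/

/-- Termwise comparison with the binomial expansion of (n + 1)^r, from C(n, i) ≤ n^i ≤ n^i C(r, i).
-/
theorem card_hammingBall_le (x : Assignment n) (r : ℕ) :
    (Finset.univ.filter fun x' : Assignment n => hammingDist x' x ≤ r).card ≤ (n + 1) ^ r := by
  classical
  have hinj : Set.InjOn (fun x' : Assignment n => Finset.univ.filter fun i => x' i ≠ x i)
      (Finset.univ.filter fun x' : Assignment n => hammingDist x' x ≤ r) := by
    intro y _ z _ hyz
    funext i
    have := congrArg (i ∈ ·) hyz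
    simp only [Finset.mem_filter, Finset.mem_univ, true_and, eq_iff_iff] at this
    rcases Int.units_eq_one_or (x i) with h1 | h1 <;>
      rcases Int.units_eq_one_or (y i) with h2 | h2 <;>
      rcases Int.units_eq_one_or (z i) with h3 | h3 <;>
      simp_all
  have hmaps : Set.MapsTo (fun x' : Assignment n => Finset.univ.filter fun i => x' i ≠ x i)
      (Finset.univ.filter fun x' : Assignment n => hammingDist x' x ≤ r)
      ((Finset.range (r + 1)).biUnion fun i =>
        Finset.powersetCard i (Finset.univ : Finset (Fin n))) := by
    intro y hy
    simp only [Finset.coe_filter, Finset.mem_univ, true_and, Set.mem_ofPred_eq] at hy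
    simpa [Nat.lt_succ_iff, hammingDist] using hy
  refine (Finset.card_le_card_of_injOn _ hmaps hinj).trans (Finset.card_biUnion_le.trans ?_)
  rw [add_pow]
  refine Finset.sum_le_sum fun i hi => ?_
  rw [Finset.card_powersetCard, Finset.card_univ, Fintype.card_fin, one_pow, mul_one]
  exact (Nat.choose_le_pow n i).trans
    (Nat.le_mul_of_pos_right _ (Nat.choose_pos (by simpa [Nat.lt_succ_iff] using hi)))

/-- The slack between 12/5 and 3 serves twice: for η ≤ 1/(3n) the radius is at most 4/5, so its
floor is 0; otherwise log(n + 1) ≤ (5/4) log n, valid for n ≥ 4, and (12/5)(5/4) = 3. -/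
theorem two_mul_pow_le_countBound (hn : 4 ≤ n) {η : ℝ} (hη : 0 ≤ η) :
    2 * ((n : ℝ) + 1) ^ ⌊12 / 5 * (η * n)⌋₊ ≤ countBound n η := by
  have hn0 : (0 : ℝ) < n := by exact_mod_cast (by omega : 0 < n)
  rw [countBound]
  split_ifs with h
  · have : ⌊12 / 5 * (η * n)⌋₊ = 0 := by
      rw [Nat.floor_eq_zero]
      rw [le_div_iff₀ (by positivity)] at h
      linarith
    rw [this]
    norm_num
  · have hlog : Real.log (n + 1) ≤ 5 / 4 * Real.log n := by
      have h1 : ((n : ℝ) + 1) ^ 4 ≤ (n : ℝ) ^ 5 := by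
        have h4 : (4 : ℝ) ≤ n := by exact_mod_cast hn
        have : (n : ℝ) + 1 ≤ 5 / 4 * n := by linarith
        calc ((n : ℝ) + 1) ^ 4 ≤ (5 / 4 * n) ^ 4 := by gcongr
          _ = 625 / 256 * (n : ℝ) ^ 4 := by ring
          _ ≤ n * (n : ℝ) ^ 4 := by gcongr; linarith
          _ = _ := by ring
      have h2 := Real.log_le_log (by positivity) h1
      rw [Real.log_pow, Real.log_pow] at h2
      push_cast at h2
      linarith
    have hfl := Nat.floor_le (show 0 ≤ 12 / 5 * (η * n) by positivity)
    have hlog0 : 0 ≤ Real.log (n + 1) := Real.log_nonneg (by linarith)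
    refine mul_le_mul_of_nonneg_left ?_ zero_le_two
    rw [← Real.exp_log (show (0 : ℝ) < n + 1 by positivity), ← Real.exp_nat_mul,
      Real.exp_le_exp]
    calc (⌊12 / 5 * (η * n)⌋₊ : ℝ) * Real.log (n + 1)
        ≤ 12 / 5 * (η * n) * (5 / 4 * Real.log n) := by gcongr
      _ = _ := by ring

theorem IsCertified.ncard_le (h : IsCertified j G) (b : Signing n) {η : ℝ} (hη : 0 ≤ η) :
    (({x : Assignment n | IsApproxSat G b η x}.ncard : ℕ) : ℝ) ≤ countBound n η := by
  classical
  refine le_trans ?_ (two_mul_pow_le_countBound h.1 hη)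
  set r := ⌊12 / 5 * (η * n)⌋₊
  rcases Set.eq_empty_or_nonempty {x : Assignment n | IsApproxSat G b η x} with h0 | ⟨x, hx⟩
  · rw [h0]
    simp only [Set.ncard_empty, Nat.cast_zero]
    positivity
  · have hsub : {x : Assignment n | IsApproxSat G b η x} ⊆
        ((Finset.univ.filter fun x' : Assignment n => hammingDist x' x ≤ r) ∪
          Finset.univ.filter fun x' : Assignment n => hammingDist x' (-x) ≤ r :
            Finset (Assignment n)) := by
      intro x' hx'
      simp only [Finset.coe_union, Finset.coe_filter, Finset.mem_univ, true_and, Set.mem_union,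
        Set.mem_ofPred_eq]
      exact (h.hammingDist_le_or hx hx').imp Nat.le_floor Nat.le_floor
    have h1 := Set.ncard_le_ncard hsub (Finset.finite_toSet _)
    rw [Set.ncard_coe_finset] at h1
    have h2 := h1.trans (Finset.card_union_le _ _)
    have h3 := h2.trans (add_le_add (card_hammingBall_le x r) (card_hammingBall_le (-x) r))
    rw [← two_mul] at h3
    exact_mod_cast h3

theorem ncard_assignment_le (s : Set (Assignment n)) : ((s.ncard : ℕ) : ℝ) ≤ 2 ^ n := by
  have h := Set.ncard_le_card s
  rw [Nat.card_eq_fintype_card, Fintype.card_fun, Fintype.card_fin] at h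
  exact_mod_cast h

end Soundness

end TwoXor

namespace TwoXor

/-! ### Concentration -/

section Chernoff

variable {ι : Type*} [Fintype ι]

/-- The number of `true` coordinates of `G` in `E` minus its expectation, when the coordinates
are `true` with probability `p`. -/
noncomputable def excess (p : ℝ) (E : Finset ι) (G : ι → Bool) : ℝ :=
  ∑ e ∈ E, ((if G e = true then 1 else 0) - p)

/-- The product of Bernoulli measures. -/
noncomputable abbrev bernoulliPi (ι : Type*) [Fintype ι] (p : unitInterval) : Measure (ι → Bool) :=
  Measure.pi fun _ => ProbabilityTheory.bernoulliMeasure true false p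

/-- From 1 + y ≤ e^y and e^θ - 1 - θ ≤ θ². Keeping the factor `p` in the exponent is what makes the
bound useful for sparse graphs. -/
theorem integral_bernoulli_exp_le (p : unitInterval) {θ : ℝ} (hθ : |θ| ≤ 1) :
    ∫ b, Real.exp (θ * ((if b = true then 1 else 0) - (p : ℝ)))
      ∂(ProbabilityTheory.bernoulliMeasure true false p) ≤ Real.exp (p * θ ^ 2) := by
  have hp := p.2.1
  have h1 : ∫ b, Real.exp (θ * ((if b = true then 1 else 0) - (p : ℝ)))
      ∂(ProbabilityTheory.bernoulliMeasure true false p) =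
        p * Real.exp (θ * (1 - p)) + (1 - p) * Real.exp (θ * (0 - p)) := by
    rw [integral_fintype Integrable.of_finite]
    simp [ProbabilityTheory.bernoulliMeasure_real_apply]
  have h2 := (abs_le.1 (Real.abs_exp_sub_one_sub_id_le hθ)).2
  have h3 := Real.add_one_le_exp ((p : ℝ) * (Real.exp θ - 1))
  have h4 : (p : ℝ) * (Real.exp θ - 1 - θ) ≤ p * θ ^ 2 := mul_le_mul_of_nonneg_left h2 hp
  rw [h1]
  calc (p : ℝ) * Real.exp (θ * (1 - p)) + (1 - p) * Real.exp (θ * (0 - p))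
      = (p * (Real.exp θ - 1) + 1) * Real.exp (-(θ * p)) := by
        rw [show θ * (1 - (p : ℝ)) = θ + -(θ * p) by ring, Real.exp_add,
          show θ * (0 - (p : ℝ)) = -(θ * p) by ring]
        ring
    _ ≤ Real.exp (p * (Real.exp θ - 1)) * Real.exp (-(θ * p)) := by gcongr
    _ = Real.exp (p * (Real.exp θ - 1 - θ)) := by rw [← Real.exp_add]; ring_nf
    _ ≤ _ := Real.exp_le_exp.2 h4

theorem integral_exp_excess_le (p : unitInterval) (E : Finset ι) {θ : ℝ} (hθ : |θ| ≤ 1) :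
    ∫ G, Real.exp (θ * excess p E G) ∂(bernoulliPi ι p) ≤ Real.exp (E.card * ((p : ℝ) * θ ^ 2)) := by
  classical
  have h1 : ∀ G : ι → Bool, Real.exp (θ * excess p E G) =
      ∏ e, if e ∈ E then Real.exp (θ * ((if G e = true then 1 else 0) - (p : ℝ))) else 1 := by
    intro G
    rw [excess, Finset.mul_sum, Real.exp_sum]
    simp
  simp only [h1]
  rw [integral_fintype_prod_eq_prod (fun e b =>
    if e ∈ E then Real.exp (θ * ((if b = true then 1 else 0) - (p : ℝ))) else 1)]
  calc _ ≤ ∏ e, if e ∈ E then Real.exp (p * θ ^ 2) else 1 := by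
        refine Finset.prod_le_prod (fun e _ => integral_nonneg fun b => ?_) fun e _ => ?_
        · dsimp only
          split_ifs <;> positivity
        · by_cases he : e ∈ E
          · simpa only [he, if_true] using integral_bernoulli_exp_le p hθ
          · simp [he]
    _ = _ := by simp [Real.exp_nat_mul]

theorem measure_le_mul_excess_le (p : unitInterval) (E : Finset ι) {θ : ℝ} (hθ : |θ| ≤ 1) (a : ℝ) :
    (bernoulliPi ι p).real {G | a ≤ θ * excess p E G} ≤
      Real.exp (E.card * ((p : ℝ) * θ ^ 2) - a) := by
  have h := mul_meas_ge_le_integral_of_nonneg (μ := bernoulliPi ι p)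
    (f := fun G => Real.exp (θ * excess p E G)) (ae_of_all _ fun G => (Real.exp_pos _).le)
    Integrable.of_finite (Real.exp a)
  simp only [Real.exp_le_exp] at h
  rw [Real.exp_sub, le_div_iff₀ (Real.exp_pos a), mul_comm]
  exact h.trans (integral_exp_excess_le p E hθ)

/-- Bernstein's inequality for sums of Bernoulli variables. -/
theorem measure_lt_abs_excess_le (p : unitInterval) (E : Finset ι) {l q : ℝ} (hl : 0 < l)
    (h1 : q ≤ l / 2) (h2 : 4 * ((p : ℝ) * E.card) * q ≤ l ^ 2) :
    (bernoulliPi ι p).real {G | l < |excess p E G|} ≤ 2 * Real.exp (-q) := by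
  have hp := p.2.1
  -- The minimizer of p|E|θ² - θl is l/(2p|E|). If it exceeds 1, then θ = 1 already gives less than
  -- -l/2.
  obtain ⟨θ, h0, hθ, hq⟩ : ∃ θ : ℝ, 0 ≤ θ ∧ θ ≤ 1 ∧ E.card * ((p : ℝ) * θ ^ 2) - θ * l ≤ -q := by
    rcases le_or_gt l (2 * (p * E.card)) with h | h
    · have hpos : 0 < (p : ℝ) * E.card := by linarith
      refine ⟨l / (2 * (p * E.card)), by positivity, (div_le_one (by positivity)).2 h, ?_⟩
      have : (E.card : ℝ) * (p * (l / (2 * (p * E.card))) ^ 2) - l / (2 * (p * E.card)) * l =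
          -(l ^ 2 / (4 * (p * E.card))) := by
        have hp0 : (p : ℝ) ≠ 0 := fun h => by simp [h] at hpos
        have hE0 : (E.card : ℝ) ≠ 0 := fun h => by simp [h] at hpos
        field_simp
        norm_num
      rw [this, neg_le_neg_iff, le_div_iff₀ (by positivity)]
      linarith
    · exact ⟨1, zero_le_one, le_rfl, by linarith⟩
  have hsub : {G | l < |excess p E G|} ⊆
      {G | θ * l ≤ θ * excess p E G} ∪ {G | θ * l ≤ (-θ) * excess p E G} := by
    intro G hG
    rcases lt_abs.1 (show l < |excess p E G| from hG) with h | h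
    · exact .inl (mul_le_mul_of_nonneg_left h.le h0)
    · right
      change θ * l ≤ -θ * excess p E G
      rw [neg_mul_comm]
      exact mul_le_mul_of_nonneg_left h.le h0
  have ha : |θ| ≤ 1 := by rwa [abs_of_nonneg h0]
  have hb : |-θ| ≤ 1 := by rwa [abs_neg]
  calc _ ≤ _ := measureReal_mono hsub
    _ ≤ _ := measureReal_union_le _ _
    _ ≤ Real.exp (-q) + Real.exp (-q) := by
      refine add_le_add ((measure_le_mul_excess_le p E ha _).trans (Real.exp_le_exp.2 hq))
        ((measure_le_mul_excess_le p E hb _).trans (Real.exp_le_exp.2 ?_))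
      rwa [neg_sq]
    _ = _ := by ring

end Chernoff

/-! ### Degrees and discrepancy of the random graph -/

section RandomGraph

variable {n : ℕ}

/-- The out-degrees and in-degrees of `G` are close to `p * n`. -/
def IsNearlyRegular (p : ℝ) (G : PairGraph n) : Prop :=
  ∀ u, |excess p ({u} ×ˢ Finset.univ) G| ≤ p * n / 50 ∧
    |excess p (Finset.univ ×ˢ {u}) G| ≤ p * n / 50

/-- Two vertex sets are comparable if their sizes differ at most by a factor that depends on the
expected degree and a discrepancy parameter `α`. -/
def Comparable (p α : ℝ) (S T : Finset (Fin n)) : Prop :=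
  α ^ 2 * T.card ≤ 4 * (p * n) ^ 2 * S.card ∧ α ^ 2 * S.card ≤ 4 * (p * n) ^ 2 * T.card

/-- The number of edges between comparable vertex sets is close to its expectation. -/
def HasComparableDiscrepancy (p α : ℝ) (G : PairGraph n) : Prop :=
  ∀ S T : Finset (Fin n), S.Nonempty → T.Nonempty → Comparable p α S T →
    |excess p (S ×ˢ T) G| ≤ α * √(S.card * T.card)

theorem measure_not_isNearlyRegular_le (p : unitInterval) (hp : 0 < (p : ℝ) * n) :
    (bernoulliPi (Fin n × Fin n) p).real {G : PairGraph n | ¬ IsNearlyRegular (p : ℝ) G} ≤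
      4 * n * Real.exp (-((p : ℝ) * n / 10000)) := by
  have hsub : {G : PairGraph n | ¬ IsNearlyRegular (p : ℝ) G} ⊆ ⋃ u ∈ (Finset.univ : Finset (Fin n)),
      ({G | (p : ℝ) * n / 50 < |excess p ({u} ×ˢ Finset.univ) G|} ∪
        {G | (p : ℝ) * n / 50 < |excess p (Finset.univ ×ˢ {u}) G|}) := by
    intro G hG
    have hG : ¬ IsNearlyRegular (p : ℝ) G := hG
    simp only [IsNearlyRegular, not_forall, not_and_or, not_le] at hG
    simpa using hG
  have hq : (p : ℝ) * n / 10000 ≤ p * n / 50 / 2 := by linarith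
  have hq2 : 4 * (p * (n : ℝ)) * (p * n / 10000) ≤ (p * n / 50) ^ 2 := by
    apply le_of_eq; ring
  calc _ ≤ _ := measureReal_mono hsub (measure_ne_top _ _)
    _ ≤ _ := measureReal_biUnion_finset_le _ _
    _ ≤ ∑ u : Fin n, (2 * Real.exp (-((p : ℝ) * n / 10000)) + 2 * Real.exp (-((p : ℝ) * n / 10000))) := by
      refine Finset.sum_le_sum fun u _ => (measureReal_union_le _ _).trans (add_le_add ?_ ?_)
      · exact measure_lt_abs_excess_le p _ (by positivity) hq (by simpa using hq2)
      · exact measure_lt_abs_excess_le p _ (by positivity) hq (by simpa using hq2)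
    _ = _ := by simp; ring

/-- The sum over all sets is (1 + e^(-Q))^n; removing the empty set subtracts 1, and e^y - 1 ≤ 2y
for 0 ≤ y ≤ 1. -/
theorem sum_nonempty_exp_le {Q : ℝ} (hQ : n * Real.exp (-Q) ≤ 1) :
    ∑ S ∈ (Finset.univ : Finset (Finset (Fin n))).filter (·.Nonempty), Real.exp (-(Q * S.card)) ≤
      2 * (n * Real.exp (-Q)) := by
  have h1 : ∑ S : Finset (Fin n), Real.exp (-(Q * S.card)) = (1 + Real.exp (-Q)) ^ n := by
    have := Finset.sum_pow_mul_eq_add_pow (Real.exp (-Q)) 1 (Finset.univ : Finset (Fin n))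
    simp only [Finset.powerset_univ, one_pow, mul_one, Finset.card_univ, Fintype.card_fin] at this
    rw [add_comm, ← this]
    refine Finset.sum_congr rfl fun S _ => ?_
    rw [← Real.exp_nat_mul]
    ring_nf
  have h2 : ∑ S : Finset (Fin n), Real.exp (-(Q * S.card)) =
      ∑ S ∈ (Finset.univ : Finset (Finset (Fin n))).filter (·.Nonempty),
        Real.exp (-(Q * S.card)) + 1 := by
    rw [← Finset.sum_filter_add_sum_filter_not Finset.univ (·.Nonempty)]
    simp [Finset.filter_eq']
  have h3 : (1 + Real.exp (-Q)) ^ n ≤ Real.exp (n * Real.exp (-Q)) := by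
    rw [Real.exp_nat_mul, add_comm]
    gcongr
    exact Real.add_one_le_exp _
  have h0 : 0 ≤ n * Real.exp (-Q) := by positivity
  have h4 := Real.abs_exp_sub_one_le (x := n * Real.exp (-Q)) (by rwa [abs_of_nonneg h0])
  rw [abs_of_nonneg h0] at h4
  have := le_abs_self (Real.exp (n * Real.exp (-Q)) - 1)
  linarith

/-- Comparability bounds the larger size by (2pn/α)√(st), so the linear deviation exponent α√(st)/2
dominates a multiple of s + t. -/
theorem exponent_le {p α s t : ℝ} (hp : 0 < p * n) (hα : 0 < α) (hs : 0 ≤ s) (ht : 0 ≤ t)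
    (hst : s ≤ t) (h : α ^ 2 * t ≤ 4 * (p * n) ^ 2 * s) :
    α ^ 2 / (8 * (p * n)) * (s + t) ≤ α * √(s * t) / 2 := by
  have h1 : α * t ≤ 2 * (p * n) * √(s * t) := by
    refine (sq_le_sq₀ (by positivity) (by positivity)).1 ?_
    rw [mul_pow _ (√(s * t)), Real.sq_sqrt (by positivity)]
    calc (α * t) ^ 2 = α ^ 2 * t * t := by ring
      _ ≤ 4 * (p * n) ^ 2 * s * t := by gcongr
      _ = _ := by ring
  rw [div_mul_eq_mul_div, div_le_iff₀ (by positivity)]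
  calc α ^ 2 * (s + t) ≤ α ^ 2 * (t + t) := by gcongr
    _ = 2 * α * (α * t) := by ring
    _ ≤ 2 * α * (2 * (p * n) * √(s * t)) := by gcongr
    _ = _ := by ring

/-- Each pair fails with probability at most 2e^(-Q|S|)e^(-Q|T|), so the union bound factors into
two sums over single sets. Bernstein's quadratic condition holds because |S| + |T| ≤ 2n. -/
theorem measure_not_hasComparableDiscrepancy_le (p : unitInterval) (hp : 0 < (p : ℝ) * n) {α : ℝ}
    (hα : 0 < α) (hQ : n * Real.exp (-(α ^ 2 / (8 * (p * n)))) ≤ 1) :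
    (bernoulliPi (Fin n × Fin n) p).real
      {G : PairGraph n | ¬ HasComparableDiscrepancy (p : ℝ) α G} ≤
      8 * (n * Real.exp (-(α ^ 2 / (8 * (p * n))))) := by
  classical
  set Q := α ^ 2 / (8 * (p * n)) with hQd
  set F := (Finset.univ : Finset (Finset (Fin n))).filter (·.Nonempty) with hF
  set bad : Finset (Fin n) × Finset (Fin n) → Set (PairGraph n) := fun P =>
    {G | Comparable (p : ℝ) α P.1 P.2 ∧
      α * √(P.1.card * P.2.card) < |excess p (P.1 ×ˢ P.2) G|} with hbad
  have hsub : {G : PairGraph n | ¬ HasComparableDiscrepancy (p : ℝ) α G} ⊆ ⋃ P ∈ F ×ˢ F, bad P := by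
    intro G hG
    have hG : ¬ HasComparableDiscrepancy (p : ℝ) α G := hG
    simp only [HasComparableDiscrepancy, not_forall, not_le] at hG
    obtain ⟨S, T, hS, hT, hc, h⟩ := hG
    simp only [Set.mem_iUnion]
    exact ⟨(S, T), by simp [hF, hS, hT], hc, h⟩
  have hone : ∀ P ∈ F ×ˢ F, (bernoulliPi (Fin n × Fin n) p).real (bad P) ≤
      2 * (Real.exp (-(Q * P.1.card)) * Real.exp (-(Q * P.2.card))) := by
    rintro ⟨S, T⟩ hP
    simp only [hF, Finset.mem_product, Finset.mem_filter, Finset.mem_univ, true_and] at hP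
    by_cases hc : Comparable (p : ℝ) α S T
    swap
    · simp only [hbad, hc, false_and]
      simp only [Set.ofPred_false, measureReal_empty]
      positivity
    have hs : (0 : ℝ) < S.card := by exact_mod_cast hP.1.card_pos
    have ht : (0 : ℝ) < T.card := by exact_mod_cast hP.2.card_pos
    have hsn : (S.card : ℝ) ≤ n := by exact_mod_cast card_finset_fin_le S
    have htn : (T.card : ℝ) ≤ n := by exact_mod_cast card_finset_fin_le T
    have hn : (0 : ℝ) < n := hs.trans_le hsn
    have hp0 : (0 : ℝ) < p := pos_of_mul_pos_left hp hn.le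
    rw [← Real.exp_add, ← neg_add, ← mul_add]
    refine (measureReal_mono fun G hG => hG.2).trans
      (measure_lt_abs_excess_le p (S ×ˢ T) (by positivity) ?_ ?_)
    · rcases le_total (S.card : ℝ) T.card with h | h
      · exact exponent_le hp hα hs.le ht.le h hc.1
      · rw [add_comm, mul_comm (S.card : ℝ) T.card]
        exact exponent_le hp hα ht.le hs.le h hc.2
    · rw [mul_pow, Real.sq_sqrt (by positivity), Finset.card_product, hQd, ← mul_assoc]
      push_cast
      rw [mul_div_assoc', div_mul_eq_mul_div, div_le_iff₀ (by positivity)]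
      have : (S.card : ℝ) + T.card ≤ 2 * n := by linarith
      calc 4 * ((p : ℝ) * (S.card * T.card)) * α ^ 2 * (S.card + T.card)
          ≤ 4 * ((p : ℝ) * (S.card * T.card)) * α ^ 2 * (2 * n) := by gcongr
        _ = _ := by ring
  have hsum := sum_nonempty_exp_le hQ
  have h0 : 0 ≤ n * Real.exp (-Q) := by positivity
  calc _ ≤ _ := measureReal_mono hsub (measure_ne_top _ _)
    _ ≤ _ := measureReal_biUnion_finset_le _ _
    _ ≤ _ := Finset.sum_le_sum hone
    _ = 2 * ((∑ S ∈ F, Real.exp (-(Q * S.card))) * ∑ S ∈ F, Real.exp (-(Q * (S.card : ℝ)))) := by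
      rw [← Finset.mul_sum, Finset.sum_product, Finset.sum_mul_sum]
    _ ≤ 2 * ((2 * (n * Real.exp (-Q))) * (2 * (n * Real.exp (-Q)))) := by
      have : 0 ≤ ∑ S ∈ F, Real.exp (-(Q * S.card)) :=
        Finset.sum_nonneg fun S _ => (Real.exp_pos _).le
      gcongr
    _ = 8 * (n * Real.exp (-Q)) * (n * Real.exp (-Q)) := by ring
    _ ≤ 8 * (n * Real.exp (-Q)) * 1 := by gcongr
    _ = _ := mul_one _

end RandomGraph

end TwoXor

namespace TwoXor

/-! ### From discrepancy to quadratic forms -/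

section BinaryDigits

variable {n : ℕ}

/-- The vertices `u` for which the binary digit `b` of `x u` is `1`. -/
def digitSet (x : Fin n → ℕ) (b : ℕ) : Finset (Fin n) :=
  Finset.univ.filter fun u => b ∈ (x u).bitIndices.toFinset

theorem two_pow_le_of_mem {k b : ℕ} (hb : b ∈ k.bitIndices.toFinset) : 2 ^ b ≤ k :=
  Nat.two_pow_le_of_mem_bitIndices (List.mem_toFinset.1 hb)

theorem bitIndices_subset_range {k L : ℕ} (hk : k < 2 ^ L) :
    k.bitIndices.toFinset ⊆ Finset.range L := fun _ hb =>
  Finset.mem_range.2 ((Nat.pow_lt_pow_iff_right (by norm_num)).1 ((two_pow_le_of_mem hb).trans_lt hk))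

theorem sum_digitSet {x : Fin n → ℕ} {L : ℕ} (hx : ∀ u, x u < 2 ^ L) (u : Fin n) :
    (x u : ℝ) = ∑ b ∈ Finset.range L, if u ∈ digitSet x b then (2 : ℝ) ^ b else 0 := by
  conv_lhs => rw [← Finset.sum_toFinset_bitIndices_two_pow (x u)]
  simp only [digitSet, Finset.mem_filter, Finset.mem_univ, true_and]
  rw [Finset.sum_ite_mem, Finset.inter_eq_right.2 (bitIndices_subset_range (hx u))]
  push_cast
  rfl

/-- If digit b of `x u` is set, then 4^b ≤ 2^b · `x u`; summing over the set digits reassembles `x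
u`. -/
theorem sum_four_pow_mul_card_le {x : Fin n → ℕ} {L : ℕ} (hx : ∀ u, x u < 2 ^ L) :
    ∑ b ∈ Finset.range L, (2 ^ b * √((digitSet x b).card)) ^ 2 ≤ ∑ u, (x u : ℝ) ^ 2 := by
  calc ∑ b ∈ Finset.range L, (2 ^ b * √((digitSet x b).card)) ^ 2
      = ∑ b ∈ Finset.range L, ∑ u, if u ∈ digitSet x b then (2 : ℝ) ^ b * 2 ^ b else 0 := by
        refine Finset.sum_congr rfl fun b _ => ?_
        rw [mul_pow, Real.sq_sqrt (by positivity)]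
        simp
        ring
    _ ≤ ∑ b ∈ Finset.range L, ∑ u, (if u ∈ digitSet x b then (2 : ℝ) ^ b else 0) * x u := by
        refine Finset.sum_le_sum fun b _ => Finset.sum_le_sum fun u _ => ?_
        split_ifs with h
        · have : (2 : ℝ) ^ b ≤ x u := by
            exact_mod_cast two_pow_le_of_mem (by simpa [digitSet] using h)
          gcongr
        · simp
    _ = ∑ u, (x u : ℝ) ^ 2 := by
        rw [Finset.sum_comm]
        refine Finset.sum_congr rfl fun u _ => ?_
        rw [← Finset.sum_mul, ← sum_digitSet hx, sq]

theorem sum_two_pow_mul_sqrt_card_le {x : Fin n → ℕ} {L : ℕ} (hx : ∀ u, x u < 2 ^ L) :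
    ∑ b ∈ Finset.range L, 2 ^ b * √((digitSet x b).card) ≤ √L * √(∑ u, (x u : ℝ) ^ 2) := by
  rw [← Real.sqrt_mul (Nat.cast_nonneg L)]
  refine Real.le_sqrt_of_sq_le ((sq_sum_le_card_mul_sum_sq).trans ?_)
  rw [Finset.card_range]
  exact mul_le_mul_of_nonneg_left (sum_four_pow_mul_card_le hx) (Nat.cast_nonneg L)

variable {M : Fin n → Fin n → ℝ} {β : ℝ}

/-- A converse of expander mixing with logarithmic loss: binary expansion of both vectors reduces
the form to rectangle sums, and Cauchy–Schwarz over the digits costs √L for each vector. -/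
theorem abs_bilin_nat_le (hβ : 0 ≤ β)
    (hM : ∀ S T : Finset (Fin n), |∑ u ∈ S, ∑ v ∈ T, M u v| ≤ β * √(S.card * T.card))
    {x y : Fin n → ℕ} {L : ℕ} (hx : ∀ u, x u < 2 ^ L) (hy : ∀ u, y u < 2 ^ L) :
    |∑ u, ∑ v, (x u : ℝ) * M u v * y v| ≤
      β * L * (√(∑ u, (x u : ℝ) ^ 2) * √(∑ u, (y u : ℝ) ^ 2)) := by
  have h1 : ∑ u, ∑ v, (x u : ℝ) * M u v * y v =
      ∑ b ∈ Finset.range L, ∑ c ∈ Finset.range L,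
        2 ^ b * 2 ^ c * ∑ u ∈ digitSet x b, ∑ v ∈ digitSet y c, M u v := by
    calc ∑ u, ∑ v, (x u : ℝ) * M u v * y v
        = ∑ u, ∑ v, ∑ b ∈ Finset.range L, ∑ c ∈ Finset.range L,
            (if u ∈ digitSet x b then (2 : ℝ) ^ b else 0) * M u v *
              (if v ∈ digitSet y c then (2 : ℝ) ^ c else 0) := by
          refine Finset.sum_congr rfl fun u _ => Finset.sum_congr rfl fun v _ => ?_
          rw [sum_digitSet hx u, sum_digitSet hy v, Finset.sum_mul, Finset.sum_mul_sum]
      _ = ∑ b ∈ Finset.range L, ∑ c ∈ Finset.range L, ∑ u, ∑ v,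
            (if u ∈ digitSet x b then (2 : ℝ) ^ b else 0) * M u v *
              (if v ∈ digitSet y c then (2 : ℝ) ^ c else 0) := by
          simp only [← Finset.sum_product']
          simp only [Finset.sum_product]
          rw [Finset.sum_comm_cycle]
          refine Finset.sum_congr rfl fun b _ => ?_
          rw [Finset.sum_comm_cycle]
      _ = _ := by
          refine Finset.sum_congr rfl fun b _ => Finset.sum_congr rfl fun c _ => ?_
          simp only [ite_mul, zero_mul, mul_ite, mul_zero, Finset.mul_sum]
          rw [← Finset.sum_filter_add_sum_filter_not Finset.univ (· ∈ digitSet x b)]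
          simp only [Finset.filter_univ_mem]
          rw [Finset.sum_eq_zero (s := Finset.univ.filter _), add_zero]
          · refine Finset.sum_congr rfl fun u hu => ?_
            simp only [hu, if_true]
            rw [Finset.sum_ite_mem, Finset.univ_inter]
            exact Finset.sum_congr rfl fun v _ => by ring
          · intro u hu
            simp [(Finset.mem_filter.1 hu).2]
  rw [h1]
  calc _ ≤ ∑ b ∈ Finset.range L, ∑ c ∈ Finset.range L,
          |2 ^ b * 2 ^ c * ∑ u ∈ digitSet x b, ∑ v ∈ digitSet y c, M u v| :=
        (Finset.abs_sum_le_sum_abs _ _).trans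
          (Finset.sum_le_sum fun _ _ => Finset.abs_sum_le_sum_abs _ _)
    _ ≤ ∑ b ∈ Finset.range L, ∑ c ∈ Finset.range L,
          β * ((2 ^ b * √((digitSet x b).card)) * (2 ^ c * √((digitSet y c).card))) := by
        refine Finset.sum_le_sum fun b _ => Finset.sum_le_sum fun c _ => ?_
        rw [abs_mul, abs_of_nonneg (by positivity)]
        have := hM (digitSet x b) (digitSet y c)
        rw [Real.sqrt_mul (Nat.cast_nonneg _)] at this
        calc (2 : ℝ) ^ b * 2 ^ c * |∑ u ∈ digitSet x b, ∑ v ∈ digitSet y c, M u v|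
            ≤ 2 ^ b * 2 ^ c * (β * (√((digitSet x b).card) * √((digitSet y c).card))) := by gcongr
          _ = _ := by ring
    _ = β * ((∑ b ∈ Finset.range L, 2 ^ b * √((digitSet x b).card)) *
          ∑ c ∈ Finset.range L, 2 ^ c * √((digitSet y c).card)) := by
        rw [Finset.sum_mul_sum]
        simp only [Finset.mul_sum]
    _ ≤ β * ((√L * √(∑ u, (x u : ℝ) ^ 2)) * (√L * √(∑ u, (y u : ℝ) ^ 2))) := by
        have := sum_two_pow_mul_sqrt_card_le hx
        have := sum_two_pow_mul_sqrt_card_le hy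
        gcongr
    _ = β * (√L * √L) * (√(∑ u, (x u : ℝ) ^ 2) * √(∑ u, (y u : ℝ) ^ 2)) := by ring
    _ = _ := by rw [Real.mul_self_sqrt (Nat.cast_nonneg L)]

/-- Positive and negative parts of both vectors give four forms, hence the factor 4. -/
theorem abs_bilin_int_le (hβ : 0 ≤ β)
    (hM : ∀ S T : Finset (Fin n), |∑ u ∈ S, ∑ v ∈ T, M u v| ≤ β * √(S.card * T.card))
    {x y : Fin n → ℤ} {L : ℕ} (hx : ∀ u, |x u| < 2 ^ L) (hy : ∀ u, |y u| < 2 ^ L) :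
    |∑ u, ∑ v, (x u : ℝ) * M u v * y v| ≤
      4 * β * L * (√(∑ u, (x u : ℝ) ^ 2) * √(∑ u, (y u : ℝ) ^ 2)) := by
  have hlt : ∀ z : ℤ, |z| < 2 ^ L → z.toNat < 2 ^ L ∧ (-z).toNat < 2 ^ L := by
    intro z hz
    obtain ⟨h1, h2⟩ := abs_lt.1 hz
    have h0 : (0 : ℤ) < 2 ^ L := by positivity
    constructor <;> zify <;> rw [Int.ofNat_toNat] <;> exact max_lt (by linarith) h0
  have hsq : ∀ z : ℤ, ((z.toNat : ℕ) : ℝ) ^ 2 ≤ (z : ℝ) ^ 2 ∧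
      (((-z).toNat : ℕ) : ℝ) ^ 2 ≤ (z : ℝ) ^ 2 := by
    intro z
    have h1 : z.toNat ≤ z.natAbs := by omega
    have h2 : (-z).toNat ≤ z.natAbs := by omega
    have h3 : (z : ℝ) ^ 2 = (z.natAbs : ℝ) ^ 2 := by rw [Nat.cast_natAbs, Int.cast_abs, sq_abs]
    rw [h3]
    constructor <;> gcongr
  have hsplit : ∀ z : ℤ, (z : ℝ) = (z.toNat : ℝ) - ((-z).toNat : ℝ) := fun z => by
    exact_mod_cast (Int.toNat_sub_toNat_neg z).symm
  set X := √(∑ u, (x u : ℝ) ^ 2)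
  set Y := √(∑ u, (y u : ℝ) ^ 2)
  have key : ∀ x' y' : Fin n → ℕ, (∀ u, x' u < 2 ^ L) → (∀ u, y' u < 2 ^ L) →
      (∀ u, (x' u : ℝ) ^ 2 ≤ (x u : ℝ) ^ 2) → (∀ u, (y' u : ℝ) ^ 2 ≤ (y u : ℝ) ^ 2) →
      |∑ u, ∑ v, (x' u : ℝ) * M u v * y' v| ≤ β * L * (X * Y) := by
    intro x' y' h1 h2 h3 h4
    refine (abs_bilin_nat_le hβ hM h1 h2).trans ?_
    have h5 : √(∑ u, (x' u : ℝ) ^ 2) ≤ X := Real.sqrt_le_sqrt (Finset.sum_le_sum fun u _ => h3 u)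
    have h6 : √(∑ u, (y' u : ℝ) ^ 2) ≤ Y := Real.sqrt_le_sqrt (Finset.sum_le_sum fun u _ => h4 u)
    gcongr
  have e : ∑ u, ∑ v, (x u : ℝ) * M u v * y v =
      ∑ u, ∑ v, ((x u).toNat : ℝ) * M u v * (y v).toNat -
      ∑ u, ∑ v, ((x u).toNat : ℝ) * M u v * (-y v).toNat -
      ∑ u, ∑ v, ((-x u).toNat : ℝ) * M u v * (y v).toNat +
      ∑ u, ∑ v, ((-x u).toNat : ℝ) * M u v * (-y v).toNat := by
    simp only [← Finset.sum_sub_distrib, ← Finset.sum_add_distrib]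
    refine Finset.sum_congr rfl fun u _ => Finset.sum_congr rfl fun v _ => ?_
    rw [hsplit (x u), hsplit (y v)]
    ring
  have xp := fun u => (hlt (x u) (hx u)).1
  have xm := fun u => (hlt (x u) (hx u)).2
  have yp := fun u => (hlt (y u) (hy u)).1
  have ym := fun u => (hlt (y u) (hy u)).2
  have xp' := fun u => (hsq (x u)).1
  have xm' := fun u => (hsq (x u)).2
  have yp' := fun u => (hsq (y u)).1
  have ym' := fun u => (hsq (y u)).2
  have k1 := abs_le.1 (key _ _ xp yp xp' yp')
  have k2 := abs_le.1 (key _ _ xp ym xp' ym')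
  have k3 := abs_le.1 (key _ _ xm yp xm' yp')
  have k4 := abs_le.1 (key _ _ xm ym xm' ym')
  rw [e, abs_le]
  constructor <;> linarith [k1.1, k1.2, k2.1, k2.2, k3.1, k3.2, k4.1, k4.2]

end BinaryDigits

/-! ### Powers of integer matrices of small discrepancy -/

section Powers

open Matrix

variable {n : ℕ} {N : Matrix (Fin n) (Fin n) ℤ} {β : ℝ}

/-- Testing the form against Ny itself gives |Ny|² ≤ 4βL|Ny||y|; integrality of `N` makes Ny a
legitimate test vector. -/
theorem sqrt_sum_mulVec_sq_le (hβ : 0 ≤ β)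
    (hN : ∀ S T : Finset (Fin n), |∑ u ∈ S, ∑ v ∈ T, (N u v : ℝ)| ≤ β * √(S.card * T.card))
    {y : Fin n → ℤ} {L : ℕ} (hx : ∀ u, |(N *ᵥ y) u| < 2 ^ L) (hy : ∀ u, |y u| < 2 ^ L) :
    √(∑ u, ((N *ᵥ y) u : ℝ) ^ 2) ≤ 4 * β * L * √(∑ u, (y u : ℝ) ^ 2) := by
  have h := abs_bilin_int_le hβ hN hx hy
  have e : ∑ u, ∑ v, ((N *ᵥ y) u : ℝ) * N u v * y v = ∑ u, ((N *ᵥ y) u : ℝ) ^ 2 := by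
    refine Finset.sum_congr rfl fun u _ => ?_
    simp only [mul_assoc]
    rw [← Finset.mul_sum, sq]
    congr 1
    simp [mulVec, dotProduct]
  have h0 : 0 ≤ ∑ u, ((N *ᵥ y) u : ℝ) ^ 2 := Finset.sum_nonneg fun u _ => sq_nonneg _
  rw [e, abs_of_nonneg h0] at h
  set X := √(∑ u, ((N *ᵥ y) u : ℝ) ^ 2) with hX
  rcases (Real.sqrt_nonneg _ : 0 ≤ X).eq_or_lt with h1 | h1
  · rw [show X = 0 from h1.symm]; positivity
  · refine le_of_mul_le_mul_left ?_ h1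
    rw [← Real.mul_self_sqrt h0, ← hX] at h
    linarith

theorem abs_pow_mulVec_single_le {B : ℤ} (hB : 0 ≤ B) (hNB : ∀ u v, |N u v| ≤ B) (i : ℕ)
    (u v : Fin n) : |((N ^ i) *ᵥ Pi.single v 1) u| ≤ (n * B) ^ i := by
  induction i generalizing u with
  | zero =>
    simp only [pow_zero, one_mulVec, Pi.single_apply]
    split_ifs <;> simp
  | succ i ih =>
    rw [pow_succ', ← mulVec_mulVec, mulVec, dotProduct]
    calc _ ≤ ∑ w, |N u w * ((N ^ i) *ᵥ Pi.single v 1) w| := Finset.abs_sum_le_sum_abs _ _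
      _ ≤ ∑ w : Fin n, B * (n * B) ^ i := by
        refine Finset.sum_le_sum fun w _ => ?_
        rw [abs_mul]
        exact mul_le_mul (hNB u w) (ih w) (abs_nonneg _) hB
      _ = _ := by simp; ring

/-- The norm bound is iterated along N^i e_v. All these vectors have entries at most (nB)^K < 2^L,
so one `L` serves every step; an entry is at most the norm of its column. -/
theorem abs_pow_apply_le (hβ : 0 ≤ β)
    (hN : ∀ S T : Finset (Fin n), |∑ u ∈ S, ∑ v ∈ T, (N u v : ℝ)| ≤ β * √(S.card * T.card))
    {B : ℤ} (hB : 1 ≤ B) (hNB : ∀ u v, |N u v| ≤ B) {L K : ℕ} (hL : ((n : ℤ) * B) ^ K < 2 ^ L)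
    (u v : Fin n) : |((N ^ K) u v : ℝ)| ≤ (4 * β * L) ^ K := by
  have hn : (1 : ℤ) ≤ n := by exact_mod_cast u.pos
  have hsmall : ∀ i ≤ K, ∀ w, |((N ^ i) *ᵥ Pi.single v 1) w| < 2 ^ L := fun i hi w =>
    ((abs_pow_mulVec_single_le (by linarith) hNB i w v).trans
      (pow_le_pow_right₀ (by nlinarith) hi)).trans_lt hL
  have hnorm : ∀ i ≤ K, √(∑ w, (((N ^ i) *ᵥ Pi.single v 1) w : ℝ) ^ 2) ≤ (4 * β * L) ^ i := by
    intro i hi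
    induction i with
    | zero => simp [Matrix.one_apply]
    | succ i ih =>
      have h1 := hsmall (i + 1) hi
      rw [pow_succ', ← mulVec_mulVec] at h1 ⊢
      refine (sqrt_sum_mulVec_sq_le hβ hN h1 (hsmall i (by omega))).trans ?_
      rw [pow_succ']
      exact mul_le_mul_of_nonneg_left (ih (by omega)) (by positivity)
  refine le_trans ?_ (hnorm K le_rfl)
  refine Real.abs_le_sqrt ?_
  have : ((N ^ K) *ᵥ Pi.single v 1) u = (N ^ K) u v := by simp
  rw [← this]
  exact Finset.single_le_sum (f := fun w => (((N ^ K) *ᵥ Pi.single v 1) w : ℝ) ^ 2)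
    (fun w _ => sq_nonneg _) (Finset.mem_univ u)

end Powers

end TwoXor

namespace TwoXor

/-! ### Pseudorandom graphs are certified -/

section Completeness

variable {n : ℕ} {p α : ℝ} {G : PairGraph n}

theorem excess_product (p : ℝ) (G : PairGraph n) (S T : Finset (Fin n)) :
    excess p (S ×ˢ T) G = ∑ u ∈ S, ∑ v ∈ T, (adjMat G u v : ℝ) - p * S.card * T.card := by
  rw [excess, Finset.sum_product]
  simp only [Finset.sum_sub_distrib, Finset.sum_const, nsmul_eq_mul, adjMat, Matrix.of_apply]
  push_cast
  ring

theorem adjMat_nonneg (u v : Fin n) : (0 : ℝ) ≤ adjMat G u v := by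
  simp only [adjMat, Matrix.of_apply]
  split_ifs <;> simp

theorem IsNearlyRegular.abs_excess_le (h : IsNearlyRegular p G) (hp : 0 < p * n)
    (S T : Finset (Fin n)) : |excess p (S ×ˢ T) G| ≤ 2 * (p * n) * S.card ∧
      |excess p (S ×ˢ T) G| ≤ 2 * (p * n) * T.card := by
  have h0 : (0 : ℝ) ≤ ∑ u ∈ S, ∑ v ∈ T, (adjMat G u v : ℝ) :=
    Finset.sum_nonneg fun u _ => Finset.sum_nonneg fun v _ => adjMat_nonneg u v
  have hn : (0 : ℝ) ≤ n := Nat.cast_nonneg n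
  have hp0 : 0 ≤ p := (pos_of_mul_pos_left hp hn).le
  have hS : (S.card : ℝ) ≤ n := by exact_mod_cast card_finset_fin_le S
  have hT : (T.card : ℝ) ≤ n := by exact_mod_cast card_finset_fin_le T
  have row : ∀ u, ∑ v ∈ T, (adjMat G u v : ℝ) ≤ 2 * (p * n) := fun u => by
    have h1 := (abs_le.1 (h u).1).2
    rw [excess_product] at h1
    have h2 : ∑ v ∈ T, (adjMat G u v : ℝ) ≤ ∑ v, (adjMat G u v : ℝ) :=
      Finset.sum_le_univ_sum_of_nonneg fun v => adjMat_nonneg u v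
    simp only [Finset.sum_singleton, Finset.card_singleton, Finset.card_univ,
      Fintype.card_fin, Nat.cast_one, mul_one] at h1
    linarith
  have col : ∀ v, ∑ u ∈ S, (adjMat G u v : ℝ) ≤ 2 * (p * n) := fun v => by
    have h1 := (abs_le.1 (h v).2).2
    rw [excess_product] at h1
    have h2 : ∑ u ∈ S, (adjMat G u v : ℝ) ≤ ∑ u, (adjMat G u v : ℝ) :=
      Finset.sum_le_univ_sum_of_nonneg fun u => adjMat_nonneg u v
    simp only [Finset.sum_singleton, Finset.card_singleton, Finset.card_univ,
      Fintype.card_fin, Nat.cast_one, mul_one] at h1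
    linarith
  rw [excess_product]
  constructor
  · have h1 : ∑ u ∈ S, ∑ v ∈ T, (adjMat G u v : ℝ) ≤ S.card * (2 * (p * n)) := by
      rw [← nsmul_eq_mul]
      exact Finset.sum_le_card_nsmul _ _ _ fun u _ => row u
    have h2 : p * S.card * T.card ≤ p * S.card * n := by gcongr
    have h3 : 0 ≤ p * S.card * T.card := by positivity
    have h4 : 0 ≤ p * S.card * n := by positivity
    rw [abs_le]
    constructor <;> linarith
  · have h1 : ∑ u ∈ S, ∑ v ∈ T, (adjMat G u v : ℝ) ≤ T.card * (2 * (p * n)) := by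
      rw [← nsmul_eq_mul, Finset.sum_comm]
      exact Finset.sum_le_card_nsmul _ _ _ fun u _ => col u
    have h2 : p * S.card * T.card ≤ p * n * T.card := by gcongr
    have h3 : 0 ≤ p * S.card * T.card := by positivity
    have h4 : 0 ≤ p * n * T.card := by positivity
    rw [abs_le]
    constructor <;> linarith

/-- For incomparable sets, the degree bound 2pn·min(|S|, |T|) is already at most α√(|S||T|), so the
union bound could skip them. -/
theorem IsNearlyRegular.abs_excess_le_sqrt (h : IsNearlyRegular p G) (hp : 0 < p * n) (hα : 0 < α)
    (hc : HasComparableDiscrepancy p α G) (S T : Finset (Fin n)) :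
    |excess p (S ×ˢ T) G| ≤ α * √(S.card * T.card) := by
  rcases S.eq_empty_or_nonempty with rfl | hS
  · simp [excess]
  rcases T.eq_empty_or_nonempty with rfl | hT
  · simp [excess]
  by_cases hST : Comparable p α S T
  · exact hc S T hS hT hST
  obtain ⟨h1, h2⟩ := h.abs_excess_le hp S T
  have sq_le : ∀ s t : ℝ, 0 ≤ s → 0 ≤ t → 4 * (p * n) ^ 2 * s ≤ α ^ 2 * t →
      2 * (p * n) * s ≤ α * √(s * t) := fun s t hs ht hst => by
    refine (sq_le_sq₀ (by positivity) (by positivity)).1 ?_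
    rw [mul_pow α, Real.sq_sqrt (by positivity)]
    calc (2 * (p * n) * s) ^ 2 = 4 * (p * n) ^ 2 * s * s := by ring
      _ ≤ α ^ 2 * t * s := by gcongr
      _ = _ := by ring
  rw [Comparable, not_and_or, not_le, not_le] at hST
  rcases hST with hlt | hlt
  · exact h1.trans (sq_le _ _ (Nat.cast_nonneg _) (Nat.cast_nonneg _) hlt.le)
  · rw [mul_comm (S.card : ℝ)]
    exact h2.trans (sq_le _ _ (Nat.cast_nonneg _) (Nat.cast_nonneg _) hlt.le)

theorem card_edges_eq (p : ℝ) (G : PairGraph n) :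
    ((edges G).card : ℝ) = excess p (Finset.univ ×ˢ Finset.univ) G + p * n * n := by
  rw [excess_product, Finset.card_univ, Fintype.card_fin, sub_add_cancel]
  exact_mod_cast (sum_adjMat G).symm

/-- The two orientations contribute 2n²α√(|S||T|). Replacing `p` by the actual density costs as much
again, since |S||T| ≤ n√(|S||T|). -/
theorem abs_sum_discMat_le (hα : 0 ≤ α)
    (h : ∀ S T : Finset (Fin n), |excess p (S ×ˢ T) G| ≤ α * √(S.card * T.card))
    (S T : Finset (Fin n)) :
    |∑ u ∈ S, ∑ v ∈ T, (discMat G u v : ℝ)| ≤ 4 * n ^ 2 * α * √(S.card * T.card) := by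
  have hS : (S.card : ℝ) ≤ n := by exact_mod_cast card_finset_fin_le S
  have hT : (T.card : ℝ) ≤ n := by exact_mod_cast card_finset_fin_le T
  have e : ∑ u ∈ S, ∑ v ∈ T, (discMat G u v : ℝ) =
      n ^ 2 * (excess p (S ×ˢ T) G + excess p (T ×ˢ S) G) -
        2 * excess p (Finset.univ ×ˢ Finset.univ) G * (S.card * T.card) := by
    have h1 : ∑ u ∈ S, ∑ v ∈ T, (discMat G u v : ℝ) =
        n ^ 2 * (∑ u ∈ S, ∑ v ∈ T, (adjMat G u v : ℝ) + ∑ u ∈ T, ∑ v ∈ S, (adjMat G u v : ℝ)) -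
          2 * (edges G).card * (S.card * T.card) := by
      rw [Finset.sum_comm (s := T)]
      simp only [discMat, Matrix.of_apply]
      push_cast
      simp only [Finset.sum_sub_distrib, mul_add, Finset.sum_add_distrib, Finset.mul_sum,
        Finset.sum_const, nsmul_eq_mul]
      ring
    rw [h1, card_edges_eq p, excess_product p G S T, excess_product p G T S]
    ring
  have hq : (S.card : ℝ) * T.card ≤ n * √(S.card * T.card) := by
    have h2 : √((S.card : ℝ) * T.card) ≤ n := by
      refine Real.sqrt_le_iff.2 ⟨Nat.cast_nonneg n, ?_⟩
      rw [sq]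
      gcongr
    calc (S.card : ℝ) * T.card = √(S.card * T.card) * √(S.card * T.card) :=
          (Real.mul_self_sqrt (by positivity)).symm
      _ ≤ _ := by gcongr
  have h1 := abs_le.1 (h S T)
  have h2 := abs_le.1 (h T S)
  rw [mul_comm (T.card : ℝ)] at h2
  have h3 : |2 * excess p (Finset.univ ×ˢ Finset.univ) G * (S.card * T.card)| ≤
      2 * (α * n) * (n * √(S.card * T.card)) := by
    have h4 := h Finset.univ Finset.univ
    rw [Finset.card_univ, Fintype.card_fin, Real.sqrt_mul_self (Nat.cast_nonneg n)] at h4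
    rw [abs_mul, abs_mul, abs_of_pos (two_pos : (0 : ℝ) < 2),
      abs_of_nonneg (show (0 : ℝ) ≤ S.card * T.card by positivity)]
    gcongr
  have h5 := abs_le.1 h3
  have hl : (n : ℝ) ^ 2 * (-(2 * (α * √(S.card * T.card)))) ≤
      n ^ 2 * (excess p (S ×ˢ T) G + excess p (T ×ˢ S) G) := by
    gcongr; linarith [h1.1, h2.1]
  have hu : (n : ℝ) ^ 2 * (excess p (S ×ˢ T) G + excess p (T ×ˢ S) G) ≤
      n ^ 2 * (2 * (α * √(S.card * T.card))) := by
    gcongr; linarith [h1.2, h2.2]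
  rw [e, abs_le]
  constructor <;> linarith [h5.1, h5.2]

theorem abs_discMat_apply_le (G : PairGraph n) (u v : Fin n) : |discMat G u v| ≤ 2 * n ^ 2 := by
  have h1 : ((edges G).card : ℤ) ≤ n ^ 2 := by
    have := Finset.card_le_univ (edges G)
    rw [Fintype.card_prod, Fintype.card_fin, ← sq] at this
    exact_mod_cast this
  have h2 : ∀ u v, 0 ≤ adjMat G u v ∧ adjMat G u v ≤ 1 := fun u v => by
    simp only [adjMat, Matrix.of_apply]
    split_ifs <;> simp
  obtain ⟨h3, h4⟩ := h2 u v
  obtain ⟨h5, h6⟩ := h2 v u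
  have h7 : (0 : ℤ) ≤ n ^ 2 * (adjMat G u v + adjMat G v u) := by positivity
  have h8 : (n : ℤ) ^ 2 * (adjMat G u v + adjMat G v u) ≤ n ^ 2 * 2 := by gcongr; linarith
  simp only [discMat, Matrix.of_apply]
  rw [abs_le]
  constructor <;> linarith

/-- Nearly regular graphs of small discrepancy are certified. -/
theorem isCertified_of_discrepancy {j L : ℕ} (hn : 4 ≤ n) (hp : 0 < p * n) (hα : 0 < α)
    (hreg : IsNearlyRegular p G) (hc : HasComparableDiscrepancy p α G)
    (hL : (2 * n ^ 3) ^ 2 ^ j < 2 ^ L)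
    (hK : n * (384 * (α * L)) ^ 2 ^ j ≤ (p * n) ^ 2 ^ j) : IsCertified j G := by
  have hn0 : (0 : ℝ) < n := by exact_mod_cast (by omega : 0 < n)
  have hrow : ∀ u, (49 / 50) * (p * n) ≤ ∑ v, (adjMat G u v : ℝ) ∧
      ∑ v, (adjMat G u v : ℝ) ≤ (51 / 50) * (p * n) := fun u => by
    have := (hreg u).1
    rw [excess_product, abs_le] at this
    simp only [Finset.sum_singleton, Finset.card_singleton, Finset.card_univ,
      Fintype.card_fin, Nat.cast_one, mul_one] at this
    constructor <;> linarith [this.1, this.2]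
  have hcol : ∀ u, (49 / 50) * (p * n) ≤ ∑ v, (adjMat G v u : ℝ) := fun u => by
    have := (hreg u).2
    rw [excess_product, abs_le] at this
    simp only [Finset.sum_singleton, Finset.card_singleton, Finset.card_univ,
      Fintype.card_fin, Nat.cast_one, mul_one] at this
    linarith [this.1]
  have he : ((edges G).card : ℝ) = ∑ u, ∑ v, (adjMat G u v : ℝ) := by
    exact_mod_cast (sum_adjMat G).symm
  have he1 : n * ((49 / 50) * (p * n)) ≤ ((edges G).card : ℝ) := by
    have := Finset.card_nsmul_le_sum Finset.univ _ _ fun u _ => (hrow u).1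
    rw [he]
    simpa using this
  have he2 : ((edges G).card : ℝ) ≤ n * ((51 / 50) * (p * n)) := by
    have := Finset.sum_le_card_nsmul Finset.univ _ _ fun u _ => (hrow u).2
    rw [he]
    simpa using this
  refine ⟨hn, ?_, fun u => ?_, fun u v => ?_⟩
  · have : (0 : ℝ) < (edges G).card := lt_of_lt_of_le (by positivity) he1
    exact_mod_cast this
  · have h1 : (46 : ℝ) * (edges G).card ≤
        24 * n * ∑ v, ((adjMat G u v : ℝ) + adjMat G v u) := by
      rw [Finset.sum_add_distrib]
      have h2 := (hrow u).1
      have h3 := hcol u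
      have h4 : 24 * (n : ℝ) * ((49 / 50) * (p * n) + (49 / 50) * (p * n)) ≤
          24 * n * (∑ v, (adjMat G u v : ℝ) + ∑ v, (adjMat G v u : ℝ)) := by gcongr
      have h5 : 0 ≤ n * (p * n) := by positivity
      linarith
    exact_mod_cast h1
  · have hdisc := abs_sum_discMat_le hα.le (hreg.abs_excess_le_sqrt hp hα hc)
    have hn1 : (1 : ℤ) ≤ n := by exact_mod_cast (by omega : 1 ≤ n)
    have hL' : ((n : ℤ) * (2 * n ^ 2)) ^ 2 ^ j < 2 ^ L := by
      rw [show (n : ℤ) * (2 * n ^ 2) = 2 * n ^ 3 by ring]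
      exact_mod_cast hL
    have hpow := abs_pow_apply_le (by positivity) hdisc (by nlinarith) (abs_discMat_apply_le G)
      hL' u v
    have : (24 : ℝ) ^ 2 ^ j * n * |((discMat G ^ 2 ^ j) u v : ℝ)| ≤
        (2 * n * (edges G).card) ^ 2 ^ j := by
      -- Here 384 = 24·4·4: the certificate, the four sign combinations, and the discrepancy of
      -- `discMat`.
      calc (24 : ℝ) ^ 2 ^ j * n * |((discMat G ^ 2 ^ j) u v : ℝ)|
          ≤ 24 ^ 2 ^ j * n * (4 * (4 * n ^ 2 * α) * L) ^ 2 ^ j := by gcongr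
        _ = (n ^ 2) ^ 2 ^ j * (n * (384 * (α * L)) ^ 2 ^ j) := by
          rw [show 4 * (4 * (n : ℝ) ^ 2 * α) * L = n ^ 2 * (16 * (α * L)) by ring, mul_pow (n ^ 2 : ℝ),
            show 384 * (α * (L : ℝ)) = 24 * (16 * (α * L)) by ring, mul_pow (24 : ℝ)]
          ring
        _ ≤ (n ^ 2) ^ 2 ^ j * (p * n) ^ 2 ^ j := by gcongr
        _ = (n * (n * (p * n))) ^ 2 ^ j := by rw [← mul_pow]; ring
        _ ≤ _ := by
          have h5 : 0 ≤ n * (p * n) := by positivity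
          refine pow_le_pow_left₀ (by positivity) ?_ _
          have h6 : n * (p * n) ≤ 2 * ((edges G).card : ℝ) := by linarith
          calc n * (n * (p * n)) ≤ n * (2 * ((edges G).card : ℝ)) := by gcongr
            _ = 2 * n * (edges G).card := by ring
    exact_mod_cast this

end Completeness

end TwoXor

namespace TwoXor

/-! ### The random graph is certified with high probability -/

section Asymptotics

open Filter

theorem eventually_digits (K : ℕ) : ∀ᶠ n : ℕ in atTop,
    (384 * ((K * (3 * Nat.log 2 n + 4) : ℕ) : ℝ)) ^ K ≤ n := by
  set c : ℝ := ((384 * (K * 10)) ^ K + 1)⁻¹ with hc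
  have hc0 : 0 < c := by positivity
  have h1 : ∀ᶠ n : ℕ in atTop, ‖Real.log n ^ K‖ ≤ c * ‖(n : ℝ)‖ :=
    tendsto_natCast_atTop_atTop.eventually
      ((Real.isLittleO_pow_log_id_atTop (n := K)).bound hc0)
  filter_upwards [h1, eventually_ge_atTop 3] with n h hn
  have hn3 : (3 : ℝ) ≤ n := by exact_mod_cast hn
  have hlog1 : 1 ≤ Real.log n := by
    rw [Real.le_log_iff_exp_le (by linarith)]
    linarith [Real.exp_one_lt_d9]
  have hl2 : (Nat.log 2 n : ℝ) ≤ 2 * Real.log n := by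
    have h2 := Real.natLog_le_logb n 2
    rw [Real.logb, Nat.cast_ofNat, le_div_iff₀ (Real.log_pos (by norm_num))] at h2
    have h3 := Real.log_two_gt_d9
    have h4 : (Nat.log 2 n : ℝ) * (1 / 2) ≤ Nat.log 2 n * Real.log 2 := by gcongr; linarith
    linarith
  rw [Real.norm_of_nonneg (by positivity), Real.norm_of_nonneg (by positivity)] at h
  calc (384 * ((K * (3 * Nat.log 2 n + 4) : ℕ) : ℝ)) ^ K
      ≤ (384 * (K * 10) * Real.log n) ^ K := by
        refine pow_le_pow_left₀ (by positivity) ?_ _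
        push_cast
        have : 3 * (Nat.log 2 n : ℝ) + 4 ≤ 10 * Real.log n := by linarith
        calc 384 * ((K : ℝ) * (3 * Nat.log 2 n + 4)) ≤ 384 * (K * (10 * Real.log n)) := by gcongr
          _ = _ := by ring
    _ = (384 * (K * 10)) ^ K * Real.log n ^ K := by rw [mul_pow]
    _ ≤ c⁻¹ * Real.log n ^ K := by
        gcongr
        rw [hc, inv_inv]
        linarith
    _ ≤ c⁻¹ * (c * n) := by gcongr
    _ = n := by rw [inv_mul_cancel_left₀ hc0.ne']

theorem eventually_failure_small {δ : ℝ} (hδ : 0 < δ) : ∀ᶠ n : ℕ in atTop,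
    12 * (n * Real.exp (-((n : ℝ) ^ (δ / 2) / 10000))) ≤ Real.exp (-(n : ℝ) ^ (δ / 4)) := by
  have h1 : ∀ᶠ n : ℕ in atTop, ‖Real.log n‖ ≤ 1 / 40000 * ‖(n : ℝ) ^ (δ / 2)‖ :=
    tendsto_natCast_atTop_atTop.eventually
      ((isLittleO_log_rpow_atTop (half_pos hδ)).bound (by norm_num))
  have h2 : ∀ᶠ n : ℕ in atTop, 40000 ≤ (n : ℝ) ^ (δ / 4) :=
    ((tendsto_rpow_atTop (by positivity : 0 < δ / 4)).comp
      tendsto_natCast_atTop_atTop).eventually_ge_atTop 40000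
  filter_upwards [h1, h2, eventually_gt_atTop 0] with n h1 h2 hn
  have hn0 : (0 : ℝ) < n := by exact_mod_cast hn
  rw [Real.norm_of_nonneg (show (0 : ℝ) ≤ (n : ℝ) ^ (δ / 2) by positivity)] at h1
  have h3 := (le_abs_self _).trans h1
  have h4 : (n : ℝ) ^ (δ / 2) = (n : ℝ) ^ (δ / 4) * (n : ℝ) ^ (δ / 4) := by
    rw [← Real.rpow_add hn0]; ring_nf
  have h5 : (12 : ℝ) ≤ Real.exp 11 := by linarith [Real.add_one_le_exp (11 : ℝ)]
  calc 12 * (n * Real.exp (-((n : ℝ) ^ (δ / 2) / 10000)))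
      ≤ Real.exp 11 * (Real.exp (Real.log n) * Real.exp (-((n : ℝ) ^ (δ / 2) / 10000))) := by
        rw [Real.exp_log hn0]; gcongr
    _ = Real.exp (11 + (Real.log n + -((n : ℝ) ^ (δ / 2) / 10000))) := by
        rw [Real.exp_add, Real.exp_add]
    _ ≤ _ := by
        rw [Real.exp_le_exp]
        -- With y = n^(δ/4) ≥ 40000 this is 11 + y²/40000 - y²/10000 ≤ -y.
        nlinarith

theorem measure_isCertified_ge {n j : ℕ} (p : unitInterval) (hn : 4 ≤ n) {δ : ℝ} (hδ : 0 < δ)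
    (hpn : (p : ℝ) * n = (n : ℝ) ^ δ) (hj : 8 ≤ δ * (2 ^ j : ℕ))
    (hdig : (384 * ((2 ^ j * (3 * Nat.log 2 n + 4) : ℕ) : ℝ)) ^ 2 ^ j ≤ n)
    (hfail : 12 * (n * Real.exp (-((n : ℝ) ^ (δ / 2) / 10000))) ≤ Real.exp (-(n : ℝ) ^ (δ / 4))) :
    1 - Real.exp (-(n : ℝ) ^ (δ / 4)) ≤
      (bernoulliPi (Fin n × Fin n) p).real {G : PairGraph n | IsCertified j G} := by
  have hn0 : (0 : ℝ) < n := by exact_mod_cast (by omega : 0 < n)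
  have hn1 : (1 : ℝ) ≤ n := by exact_mod_cast (by omega : 1 ≤ n)
  have hp : 0 < (p : ℝ) * n := by rw [hpn]; positivity
  -- A balance: α²/(pn) = n^(δ/2) must beat log n in the union bound, and pn/α = n^(δ/4) must beat
  -- `L` and n^(1/K).
  set α : ℝ := (n : ℝ) ^ (3 / 4 * δ) with hα
  have hα0 : 0 < α := by positivity
  have hQ : α ^ 2 / (8 * (p * n)) = (n : ℝ) ^ (δ / 2) / 8 := by
    have h1 : α ^ 2 = (n : ℝ) ^ (δ / 2) * (p * n) := by
      rw [hpn, hα, sq, ← Real.rpow_add hn0, ← Real.rpow_add hn0]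
      ring_nf
    rw [h1, mul_comm (8 : ℝ), mul_comm ((n : ℝ) ^ (δ / 2)), mul_div_mul_left _ _ hp.ne']
  set L := 2 ^ j * (3 * Nat.log 2 n + 4) with hLdef
  -- Entries of `discMat` are at most 2n², so 2n³ bounds the growth per multiplication.
  have hL : (2 * n ^ 3) ^ 2 ^ j < 2 ^ L := by
    rw [hLdef, mul_comm (2 ^ j), pow_mul]
    refine Nat.pow_lt_pow_left ?_ (pow_ne_zero j two_ne_zero)
    have h1 : n < 2 ^ (Nat.log 2 n + 1) := Nat.lt_pow_succ_log_self (by norm_num) n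
    calc 2 * n ^ 3 < 2 * (2 ^ (Nat.log 2 n + 1)) ^ 3 := by gcongr
      _ = _ := by ring
  have hK : n * (384 * (α * (L : ℝ))) ^ 2 ^ j ≤ ((p : ℝ) * n) ^ 2 ^ j := by
    have h1 : ((p : ℝ) * n) = (n : ℝ) ^ (δ / 4) * α := by
      rw [hpn, hα, ← Real.rpow_add hn0]
      ring_nf
    -- One factor n pays for the `n` in the certificate, the other for the digits; this needs Kδ/4 ≥
    -- 2.
    have h2 : (n : ℝ) * n ≤ ((n : ℝ) ^ (δ / 4)) ^ 2 ^ j := by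
      rw [← Real.rpow_mul_natCast hn0.le, ← sq, ← Real.rpow_natCast]
      refine Real.rpow_le_rpow_of_exponent_le hn1 ?_
      push_cast at hj ⊢
      linarith
    rw [h1, mul_pow _ α]
    calc n * (384 * (α * (L : ℝ))) ^ 2 ^ j = n * (384 * (L : ℝ)) ^ 2 ^ j * α ^ 2 ^ j := by
          rw [show 384 * (α * (L : ℝ)) = 384 * L * α by ring, mul_pow _ α]; ring
      _ ≤ n * n * α ^ 2 ^ j := by gcongr
      _ ≤ _ := by gcongr
  have hsmall : (0 : ℝ) ≤ (n : ℝ) ^ (δ / 2) := by positivity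
  have he1 : Real.exp (-((n : ℝ) ^ (δ / 2) / 8)) ≤ Real.exp (-((n : ℝ) ^ (δ / 2) / 10000)) := by
    rw [Real.exp_le_exp]; linarith
  have he2 : Real.exp (-((p : ℝ) * n / 10000)) ≤ Real.exp (-((n : ℝ) ^ (δ / 2) / 10000)) := by
    rw [Real.exp_le_exp, hpn]
    have : (n : ℝ) ^ (δ / 2) ≤ (n : ℝ) ^ δ := Real.rpow_le_rpow_of_exponent_le hn1 (by linarith)
    linarith
  have hle1 : n * Real.exp (-((n : ℝ) ^ (δ / 2) / 10000)) ≤ 1 := by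
    have h1 : Real.exp (-(n : ℝ) ^ (δ / 4)) ≤ 1 := by
      rw [Real.exp_le_one_iff]
      have : (0 : ℝ) ≤ (n : ℝ) ^ (δ / 4) := by positivity
      linarith
    have h2 : 0 ≤ n * Real.exp (-((n : ℝ) ^ (δ / 2) / 10000)) := by positivity
    linarith
  have hA := measure_not_isNearlyRegular_le p hp
  have hB := measure_not_hasComparableDiscrepancy_le p hp hα0 (by
    rw [hQ]
    exact (mul_le_mul_of_nonneg_left he1 hn0.le).trans hle1)
  rw [hQ] at hB
  have hcov : (Set.univ : Set (PairGraph n)) ⊆ {G | IsCertified j G} ∪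
      ({G | ¬ IsNearlyRegular (p : ℝ) G} ∪ {G | ¬ HasComparableDiscrepancy (p : ℝ) α G}) := by
    intro G _
    by_cases h1 : IsNearlyRegular (p : ℝ) G
    · by_cases h2 : HasComparableDiscrepancy (p : ℝ) α G
      · exact .inl (isCertified_of_discrepancy hn hp hα0 h1 h2 hL hK)
      · exact .inr (.inr h2)
    · exact .inr (.inl h1)
  have hone := (measureReal_mono (μ := bernoulliPi (Fin n × Fin n) p) hcov).trans
    ((measureReal_union_le _ _).trans (add_le_add le_rfl (measureReal_union_le _ _)))
  rw [probReal_univ] at hone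
  have hA' : 4 * n * Real.exp (-((p : ℝ) * n / 10000)) ≤
      4 * n * Real.exp (-((n : ℝ) ^ (δ / 2) / 10000)) := by gcongr
  have hB' : 8 * (n * Real.exp (-((n : ℝ) ^ (δ / 2) / 8))) ≤
      8 * (n * Real.exp (-((n : ℝ) ^ (δ / 2) / 10000))) := by gcongr
  linarith

theorem randomGraph_eq {n : ℕ} {m : ℝ} (h0 : 0 ≤ m) (h1 : m ≤ (n : ℝ) ^ 2) :
    ∃ p : unitInterval, (p : ℝ) = m / (n : ℝ) ^ 2 ∧
      randomGraph n m = bernoulliPi (Fin n × Fin n) p := by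
  have h : m / (n : ℝ) ^ 2 ∈ Set.Icc (0 : ℝ) 1 :=
    ⟨by positivity, div_le_one_of_le₀ h1 (by positivity)⟩
  exact ⟨⟨_, h⟩, rfl, by rw [randomGraph, Set.projIcc_of_mem _ h]⟩

theorem eventually_randomGraph_isCertified {δ : ℝ} (hδ : 0 < δ) (hδ1 : δ ≤ 1) {j : ℕ}
    (hj : 8 ≤ δ * (2 ^ j : ℕ)) : ∀ᶠ n : ℕ in atTop, 1 - Real.exp (-(n : ℝ) ^ (δ / 4)) ≤
      (randomGraph n ((n : ℝ) ^ (1 + δ))).real {G | IsCertified j G} := by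
  filter_upwards [eventually_digits (2 ^ j), eventually_failure_small hδ, eventually_ge_atTop 4]
    with n hdig hfail hn
  have hn0 : (0 : ℝ) < n := by exact_mod_cast (by omega : 0 < n)
  have hn1 : (1 : ℝ) ≤ n := by exact_mod_cast (by omega : 1 ≤ n)
  obtain ⟨p, hp, he⟩ := randomGraph_eq (n := n) (m := (n : ℝ) ^ (1 + δ)) (by positivity) (by
    rw [← Real.rpow_natCast]
    refine Real.rpow_le_rpow_of_exponent_le hn1 ?_
    push_cast
    linarith)
  rw [he]
  refine measure_isCertified_ge p hn hδ ?_ hj hdig hfail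
  rw [hp, Real.rpow_add hn0, Real.rpow_one]
  field_simp

end Asymptotics

end TwoXor

/-! ### Assembly of the main theorem -/

theorem mainTheorem3 :
    ∃ c : ℝ, 0 < c ∧ ∀ δ : ℝ, 0 < δ → δ ≤ 1 →
      ∃ accept : (n : ℕ) → TwoXor.PairGraph n → Bool,
        -- the algorithm runs in polynomial time
        TwoXor.PolyTime accept ∧
        -- on every graph the output bounds the count for every instance on that graph
        (∀ (n : ℕ) (G : TwoXor.PairGraph n) (η : ℝ), 0 ≤ η → η ≤ 1 →
          ∀ b : TwoXor.Signing n,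
            (({x : TwoXor.Assignment n | TwoXor.IsApproxSat G b η x}.ncard : ℕ) : ℝ)
              ≤ TwoXor.certifiedValue (accept n G) n η) ∧
        -- on acceptance, approximate solutions are pairwise close up to a global sign
        (∀ (n : ℕ) (G : TwoXor.PairGraph n), accept n G = true →
          ∀ η : ℝ, 0 ≤ η → η ≤ 1 → ∀ (b : TwoXor.Signing n) (x x' : TwoXor.Assignment n),
            TwoXor.IsApproxSat G b η x → TwoXor.IsApproxSat G b η x' →
              (hammingDist x' x : ℝ) ≤ 3 * η * n ∨ (hammingDist x' (-x) : ℝ) ≤ 3 * η * n) ∧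
        -- the random graph is accepted with high probability
        (∃ n₀ : ℕ, ∀ n : ℕ, n₀ ≤ n →
          1 - Real.exp (-(n : ℝ) ^ (c * δ)) ≤
            (TwoXor.randomGraph n ((n : ℝ) ^ (1 + δ))).real {G | accept n G = true}) := by
  classical
  refine ⟨1 / 4, by norm_num, fun δ hδ hδ1 => ?_⟩
  -- The exponent depends on δ only, so one program and one polynomial time bound serve all graphs.
  obtain ⟨j, hj⟩ := pow_unbounded_of_one_lt (8 / δ) (one_lt_two : (1 : ℝ) < 2)
  have hj' : 8 ≤ δ * (2 ^ j : ℕ) := by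
    push_cast
    rw [div_lt_iff₀ hδ] at hj
    linarith
  refine ⟨fun n G => decide (TwoXor.IsCertified j G), TwoXor.polyTime_isCertified j,
    fun n G η hη _ b => ?_, fun n G hG η hη _ b x x' hx hx' => ?_, ?_⟩
  · by_cases h : TwoXor.IsCertified j G
    · simpa [TwoXor.certifiedValue, h] using h.ncard_le b hη
    · simpa [TwoXor.certifiedValue, h] using
        TwoXor.ncard_assignment_le {x | TwoXor.IsApproxSat G b η x}
  · have hηn : 0 ≤ η * n := by positivity
    refine ((of_decide_eq_true hG).hammingDist_le_or hx hx').imp (fun h => ?_) fun h => ?_ <;>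
      linarith
  · obtain ⟨n₀, hn₀⟩ :=
      Filter.eventually_atTop.1 (TwoXor.eventually_randomGraph_isCertified hδ hδ1 hj')
    refine ⟨n₀, fun n hn => ?_⟩
    simpa [div_eq_inv_mul] using hn₀ n hn
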